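/- Let $K$ be a field and, for $n\ge 1$, let $R=K[X_1,\dots,X_n]$ with the standard grading ($\deg X_i=1$). For $k\ge1$ let $M(n,k)$ be the $k$-th syzygy module of $K=R/(X_1,\dots,X_n)$ over $R$, that is, the image of the differential $\bigwedge^k R^n\to\bigwedge^{k-1}R^n$ of the Koszul complex of $X_1,\dots,X_n$, graded so that $e_{i_1}\wedge\dots\wedge e_{i_j}$ has degree $j$. A graded retract of $R$ is a graded $K$-subalgebra $S\subseteq R$ for which there is a graded $K$-algebra epimorphism $R\to S$ that is the identity on $S$. A Hilbert decomposition of a finitely generated graded $R$-module $M$ is a finite family $(S_i,s_i)_{i\in I}$ of graded retracts $S_i$ of $R$ and integers $s_i$ such that $M\cong\bigoplus_{i\in I}S_i(-s_i)$ as graded $K$-vector spaces; its depth is the depth of the $R$-module $\bigoplus_{i\in I} S_i(-s_i)$, and the Hilbert depth $\operatorname{Hdepth}_1 M$ is the maximal depth of a Hilbert decomposition of $M$. Then, for every fixed positive integer $k$, as $n\to\infty$, $$ \operatorname{Hdepth}_1 M(n,k)=\frac12 n+\frac12\sqrt{(k-1)\,n\log n}+\frac14\sqrt{\frac{(k-1)\,n}{\log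 n}}\;\log\log n+o\!\left(\sqrt{\frac{n}{\log n}}\;\log\log n\right). $$ -/

import Mathlib

open Filter Asymptotics

namespace HilbertDepth

/-! Throughout, `K` is a field and `R = K[X₁, …, Xₙ]` is `MvPolynomial (Fin n) K` with the standard
grading, in which every variable has degree `1`. Degrees and shifts are integers. -/

section PolynomialRing

variable (K : Type*) [Field K] (n : ℕ)

/-- The homogeneous component of degree `d : ℤ` of `R` (zero for negative `d`). -/
noncomputable def component : ℤ → Submodule K (MvPolynomial (Fin n) K)
  | Int.ofNat m => MvPolynomial.homogeneousSubmodule (Fin n) K m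
  | Int.negSucc _ => ⊥

/-- The maximal graded ideal `(X₁, …, Xₙ)` of `R`. -/
noncomputable def maxGradedIdeal : Ideal (MvPolynomial (Fin n) K) :=
  Ideal.span (Set.range MvPolynomial.X)

/-- The depth of a finitely generated graded `R`-module `N`: the supremum of the lengths of
`N`-regular sequences in the maximal graded ideal. For such `N ≠ 0` the requirement
`N ≠ (x₁, …, xᵣ) N` on a regular sequence is automatic by Nakayama's lemma, which is why weakly
regular sequences are used; for `N = 0` one gets the usual value `∞`. -/
noncomputable def depth (N : Type*) [AddCommGroup N] [Module (MvPolynomial (Fin n) K) N] : ℕ∞ :=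
  ⨆ rs : {rs : List (MvPolynomial (Fin n) K) //
    (∀ x ∈ rs, x ∈ maxGradedIdeal K n) ∧ RingTheory.Sequence.IsWeaklyRegular N rs},
    (rs.1.length : ℕ∞)

/-- A graded retract of `R`: a graded `K`-subalgebra `S` of `R` with a graded epimorphism
`R → S` that restricts to the identity on `S`. It is recorded through the composite
`proj : R → S ⊆ R`, an idempotent graded `K`-algebra endomorphism of `R` with image `S`. -/
structure GradedRetract where
  proj : MvPolynomial (Fin n) K →ₐ[K] MvPolynomial (Fin n) K
  proj_proj : ∀ p, proj (proj p) = proj p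
  isHomogeneous_proj : ∀ (d : ℕ) (p : MvPolynomial (Fin n) K),
    p.IsHomogeneous d → (proj p).IsHomogeneous d

end PolynomialRing

namespace GradedRetract

variable {K : Type*} [Field K] {n : ℕ}

/-- The retract `S` itself, as a subalgebra of `R`. -/
noncomputable def toSubalgebra (S : GradedRetract K n) : Subalgebra K (MvPolynomial (Fin n) K) :=
  S.proj.range

/-- The homogeneous component `S_d`, for `d : ℤ`. -/
noncomputable def component (S : GradedRetract K n) (d : ℤ) : Submodule K (MvPolynomial (Fin n) K) :=
  Subalgebra.toSubmodule S.toSubalgebra ⊓ HilbertDepth.component K n d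

/-- The additive group of `S`, to be viewed as an `R`-module through the epimorphism `R → S`. -/
def AsModule (S : GradedRetract K n) : Type _ := S.proj.range

noncomputable instance (S : GradedRetract K n) : AddCommGroup S.AsModule :=
  inferInstanceAs (AddCommGroup S.proj.range)

noncomputable instance (S : GradedRetract K n) : Module (MvPolynomial (Fin n) K) S.AsModule :=
  Module.compHom S.proj.range S.proj.rangeRestrict.toRingHom

end GradedRetract

section HilbertDecomposition

variable (K : Type*) [Field K] (n : ℕ) {V : Type*} [AddCommGroup V] [Module K V]

/-- A Hilbert decomposition of a graded module with homogeneous components `M d`, `d : ℤ`: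
a finite family of graded retracts `Sᵢ` of `R` and of shifts `sᵢ : ℤ` such that `M` is isomorphic
to `⨁ Sᵢ(-sᵢ)` as a graded `K`-vector space, that is, degree by degree;
`(Sᵢ(-sᵢ))_d = (Sᵢ)_{d - sᵢ}`. -/
structure HilbertDecomposition (M : ℤ → Submodule K V) where
  size : ℕ
  retract : Fin size → GradedRetract K n
  shift : Fin size → ℤ
  iso : ∀ d : ℤ,
    Nonempty (M d ≃ₗ[K] ((i : Fin size) → (retract i).component (d - shift i)))

variable {K n}

/-- The depth of a Hilbert decomposition: the depth of the `R`-module `⨁ Sᵢ`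
(shifts of the grading do not affect it). -/
noncomputable def HilbertDecomposition.depth {M : ℤ → Submodule K V}
    (D : HilbertDecomposition K n M) : ℕ∞ :=
  HilbertDepth.depth K n ((i : Fin D.size) → (D.retract i).AsModule)

variable (K n)

/-- The Hilbert depth (with respect to the standard grading): the maximal depth of a Hilbert
decomposition. -/
noncomputable def hdepth (M : ℤ → Submodule K V) : ℕ∞ :=
  ⨆ D : HilbertDecomposition K n M, D.depth

end HilbertDecomposition

section Koszul

variable (K : Type*) [Field K] (n : ℕ)

/-- The exterior power `⋀ʲ Rⁿ` in coordinates: `f` stands for `∑ f(T) e_T`, where `T` runs over the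
`j`-element subsets of the index set and `e_T = e_{i₁} ∧ ⋯ ∧ e_{iⱼ}` for `T = {i₁ < ⋯ < iⱼ}`. -/
abbrev Koszul (j : ℕ) : Type _ :=
  {T : Finset (Fin n) // T.card = j} → MvPolynomial (Fin n) K

/-- The Koszul differential `⋀ʲ⁺¹ Rⁿ → ⋀ʲ Rⁿ`,
`∂(e_{i₀} ∧ ⋯ ∧ e_{iⱼ}) = ∑ᵣ (-1)ʳ X_{iᵣ} e_{i₀} ∧ ⋯ (omit e_{iᵣ}) ⋯ ∧ e_{iⱼ}`: the coefficient of
`e_T` in `∂ f` collects the contributions of all `e_{T ∪ {i}}` with `i ∉ T`. -/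
noncomputable def koszulD (j : ℕ) : Koszul K n (j + 1) →ₗ[MvPolynomial (Fin n) K] Koszul K n j where
  toFun f T := ∑ i : {i : Fin n // i ∉ T.1},
    (-1) ^ (T.1.filter (fun t => t < i.1)).card * MvPolynomial.X i.1 *
      f ⟨insert i.1 T.1, by rw [Finset.card_insert_of_notMem i.2, T.2]⟩
  map_add' f g := by
    funext T
    simp [mul_add, Finset.sum_add_distrib]
  map_smul' c f := by
    funext T
    simp only [Pi.smul_apply, smul_eq_mul, RingHom.id_apply, Finset.mul_sum]
    exact Finset.sum_congr rfl fun i _ => by ring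

/-- The homogeneous component of degree `d` of `⋀ʲ Rⁿ`, where each `e_T` has degree `j`. -/
noncomputable def Koszul.component (j : ℕ) (d : ℤ) : Submodule K (Koszul K n j) :=
  Submodule.pi Set.univ fun _ => HilbertDepth.component K n (d - j)

/-- For `k ≥ 1`, the `k`-th syzygy module `M(n, k)` of `K = R/(X₁, …, Xₙ)`: the image of the
differential `⋀ᵏ Rⁿ → ⋀ᵏ⁻¹ Rⁿ` of the Koszul complex, the minimal free resolution of `K`. -/
noncomputable def syzygy (k : ℕ) :
    Submodule (MvPolynomial (Fin n) K) (Koszul K n (k - 1)) :=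
  LinearMap.range (koszulD K n (k - 1))

/-- The homogeneous component of degree `d` of `M(n, k)`. -/
noncomputable def syzygyComponent (k : ℕ) (d : ℤ) : Submodule K (Koszul K n (k - 1)) :=
  (syzygy K n k).restrictScalars K ⊓ Koszul.component K n (k - 1) d

end Koszul

end HilbertDepth

/-! Put q = k - 1 and H = 1/(1 - X), which is `mk 1` below. Exactness of the Koszul complex shows
that M(n, k) has Hilbert series H^n * `numerator n q` (`finrank_syzygyPart`). For q + 1 ≤ n,
`le_toNat_hdepth_iff` turns the problem into one about signs: depth at least r is attained exactly
when r ≤ n and H^(n - r) * `numerator n q` has no negative coefficient. Necessity: a graded retract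
is a polynomial ring, in at least r variables if it carries a regular sequence of length r, so H^r
can be cancelled from every summand. Sufficiency: a nonnegative series of this kind is a sum of
shifted powers of H (`mem_hilbertCone_of_nonneg`).

With m = n - r, the coefficient in degree d is that of H^m * `truncBinomial n q` minus (-1)^(d + q)
binom(r, d). Write mc(m, d) for `m.multichoose d`. The first term is at least binom(r, q) mc(m, d -
q) for d > q, and at most (q + 1) (n d / m)^q mc(m, d) in absolute value: up to constants, d^q mc(m,
d) in the relevant range. Let r = n/2 + x, so r = m + 2x. The quotient binom(r, e) / mc(m, e) grows
at each step by the factor (r - e)/(m + e), roughly exp((2x - 2e)/m); it peaks near e = x, at about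
exp(2x²/n). Hence nonnegativity persists as long as exp(2x²/n) stays below a constant times x^q, and
the threshold is 2x²/n = q log x + O(1).

For q > 0, x has order √(n log n) and log x = (log n + log log n)/2 + O(1), whence x = ½ √(q n (log
n + log log n + O(1))), which expands to the claim. For q = 0 there is no polynomial gain and r
stays within a constant of n/2. -/

namespace HilbertDepth

/-! ### Coefficients of the Hilbert series after division by powers of 1/(1 - X) -/

section Series

open PowerSeries

theorem coeff_mk_one_pow (m d : ℕ) :
    coeff d ((mk 1 : ℤ⟦X⟧) ^ m) = (m.multichoose d : ℤ) := by
  cases m with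
  | zero => cases d <;> simp [coeff_one]
  | succ m =>
    rw [mk_one_pow_eq_mk_choose_add, coeff_mk, Nat.multichoose_eq,
      show m + 1 + d - 1 = m + d by omega, Nat.choose_symm_add]

theorem mk_one_pow_mul_one_sub_pow (m : ℕ) :
    (mk 1 : ℤ⟦X⟧) ^ m * (1 - X) ^ m = 1 := by
  rw [← mul_pow, mk_one_mul_one_sub_eq_one, one_pow]

theorem coeff_one_sub_pow (r d : ℕ) :
    coeff d ((1 - X : ℤ⟦X⟧) ^ r) = (-1) ^ d * (r.choose d : ℤ) := by
  induction r generalizing d with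
  | zero => cases d <;> simp [coeff_one]
  | succ r ih =>
    rw [pow_succ, mul_sub, mul_one, map_sub, ih]
    cases d with
    | zero => simp
    | succ d =>
      rw [coeff_succ_mul_X, ih, Nat.choose_succ_succ]
      push_cast
      ring

theorem coeff_mk_one_mul_succ (f : ℤ⟦X⟧) (d : ℕ) :
    coeff (d + 1) (mk 1 * f) = coeff d (mk 1 * f) + coeff (d + 1) f := by
  have h : f = (1 - X) * (mk 1 * f) := by
    rw [← mul_assoc, mul_comm (1 - X), mk_one_mul_one_sub_eq_one, one_mul]
  have h2 := congrArg (coeff (d + 1)) h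
  rw [sub_mul, one_mul, map_sub, coeff_succ_X_mul] at h2
  linarith

theorem coeff_zero_mk_one_mul (f : ℤ⟦X⟧) : coeff 0 (mk 1 * f) = coeff 0 f := by
  simp [coeff_zero_eq_constantCoeff]

theorem coeff_mk_one_mul_nonneg {f : ℤ⟦X⟧} (hf : ∀ d, 0 ≤ coeff d f) (d : ℕ) :
    0 ≤ coeff d (mk 1 * f) := by
  induction d with
  | zero => rw [coeff_zero_mk_one_mul]; exact hf 0
  | succ d ih => rw [coeff_mk_one_mul_succ]; exact add_nonneg ih (hf _)

theorem coeff_mk_one_pow_mul_nonneg {f : ℤ⟦X⟧} (hf : ∀ d, 0 ≤ coeff d f) (m d : ℕ) :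
    0 ≤ coeff d ((mk 1) ^ m * f) := by
  induction m generalizing d with
  | zero => simpa using hf d
  | succ m ih => rw [pow_succ', mul_assoc]; exact coeff_mk_one_mul_nonneg ih d

/-- `(-1)^q` times the truncation of `(1 - X)^n` in degrees at most `q`. -/
noncomputable def truncBinomial (n : ℕ) : ℕ → ℤ⟦X⟧
  | 0 => 1
  | q + 1 => (n.choose (q + 1) : ℤ⟦X⟧) * X ^ (q + 1) - truncBinomial n q

/-- The numerator of the Hilbert series of `M(n, q + 1)` over `(1 - X)^n`. -/
noncomputable def numerator (n q : ℕ) : ℤ⟦X⟧ :=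
  truncBinomial n q - (-1) ^ q * (1 - X) ^ n

theorem numerator_zero (n : ℕ) : numerator n 0 = 1 - (1 - X) ^ n := by
  simp [numerator, truncBinomial]

theorem numerator_succ (n q : ℕ) :
    numerator n (q + 1) = (n.choose (q + 1) : ℤ⟦X⟧) * X ^ (q + 1) - numerator n q := by
  simp only [numerator, truncBinomial]
  ring

theorem truncBinomial_succ_succ (n q : ℕ) :
    truncBinomial (n + 1) (q + 1) = truncBinomial n (q + 1) + X * truncBinomial n q := by
  induction q with
  | zero =>
    simp only [truncBinomial, zero_add, Nat.choose_one_right]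
    push_cast
    ring
  | succ q ih =>
    rw [truncBinomial, ih, truncBinomial, Nat.choose_succ_succ]
    simp only [truncBinomial]
    push_cast
    ring

theorem numerator_succ_succ (n q : ℕ) :
    numerator (n + 1) (q + 1) = numerator n (q + 1) + X * numerator n q := by
  simp only [numerator, truncBinomial_succ_succ]
  ring

theorem coeff_numerator (n q d : ℕ) :
    coeff d (numerator n q) = if d ≤ q then 0 else (-1) ^ (d + q + 1) * (n.choose d : ℤ) := by
  induction q with
  | zero =>
    rw [numerator_zero, map_sub, coeff_one_sub_pow]
    cases d <;> simp [coeff_one, pow_succ]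
  | succ q ih =>
    rw [numerator_succ, map_sub, ih, ← map_natCast (PowerSeries.C (R := ℤ)), coeff_C_mul,
      coeff_X_pow]
    rcases lt_trichotomy d (q + 1) with h | h | h
    · simp [h.ne, h.le, Nat.lt_succ_iff.mp h]
    · subst h
      simp [show q + 1 + q + 1 = 2 * (q + 1) by ring, pow_mul]
    · simp [h.ne', show ¬ d ≤ q by omega, show ¬ d ≤ q + 1 by omega, pow_succ, ← add_assoc]

/-- These coefficients turn out to be the dimensions of the graded pieces of M(n, q + 1). Pascal's
rule for `numerator` gives their sign without any module. -/
theorem coeff_mk_one_pow_mul_numerator_self_nonneg (n q d : ℕ) :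
    0 ≤ coeff d ((mk 1) ^ n * numerator n q) := by
  induction n generalizing q d with
  | zero =>
    rw [pow_zero, one_mul, coeff_numerator]
    split_ifs with h
    · exact le_rfl
    · simp [Nat.choose_eq_zero_of_lt (show 0 < d by omega)]
  | succ n ih =>
    cases q with
    | zero =>
      rw [numerator_zero, mul_sub, mk_one_pow_mul_one_sub_pow, mul_one, map_sub, coeff_mk_one_pow]
      cases d <;> simp [coeff_one]
    | succ q =>
      rw [numerator_succ_succ, pow_succ', mul_assoc]
      refine coeff_mk_one_mul_nonneg (fun d => ?_) d
      rw [mul_add, map_add, mul_left_comm]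
      refine add_nonneg (ih _ _) ?_
      cases d with
      | zero => simp
      | succ d => rw [coeff_succ_X_mul]; exact ih _ _

/-- The factor H^m cancels against (1 - X)^(r + m), so the full binomial contributes a single
alternating term. The depth is decided by the competition between this term and the truncated part.
-/
theorem coeff_mk_one_pow_mul_numerator (r m q d : ℕ) :
    coeff d ((mk 1) ^ m * numerator (r + m) q) =
      coeff d ((mk 1) ^ m * truncBinomial (r + m) q) - (-1) ^ (d + q) * (r.choose d : ℤ) := by
  have h : (mk 1 : ℤ⟦X⟧) ^ m * ((-1) ^ q * (1 - X) ^ (r + m)) =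
      PowerSeries.C ((-1) ^ q) * (1 - X) ^ r := by
    rw [pow_add, mul_left_comm, mul_left_comm _ ((1 - X) ^ r), mk_one_pow_mul_one_sub_pow]
    simp
  rw [numerator, mul_sub, map_sub, h, coeff_C_mul, coeff_one_sub_pow]
  ring

theorem coeff_mk_one_pow_mul_numerator_of_le {q d : ℕ} (n m : ℕ) (h : d ≤ q) :
    coeff d ((mk 1) ^ m * numerator n q) = 0 := by
  rw [coeff_mul]
  refine Finset.sum_eq_zero fun p hp => ?_
  have := Finset.HasAntidiagonal.mem_antidiagonal.mp hp
  rw [coeff_numerator, if_pos (by omega), mul_zero]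

/-- Both sides obey Pascal's rule in r. At r = 0 with positive truncation degree only nonnegativity
is needed, and there binom(0, d) = 0 identifies the coefficient with one of H^m * `numerator m`. -/
theorem choose_mul_multichoose_le_coeff (r m q d : ℕ) (h : q + 1 ≤ d) :
    (r.choose q * m.multichoose (d - q) : ℤ) ≤
      coeff d ((mk 1) ^ m * truncBinomial (r + m) q) := by
  induction r generalizing q d with
  | zero =>
    cases q with
    | zero => simp [truncBinomial, coeff_mk_one_pow]
    | succ q =>
      have := coeff_mk_one_pow_mul_numerator_self_nonneg m (q + 1) d
      have h2 := coeff_mk_one_pow_mul_numerator 0 m (q + 1) d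
      rw [Nat.choose_eq_zero_of_lt (show 0 < d by omega)] at h2
      simp_all
  | succ r ih =>
    cases q with
    | zero => simp [truncBinomial, coeff_mk_one_pow]
    | succ q =>
      obtain ⟨d, rfl⟩ : ∃ e, d = e + 1 := ⟨d - 1, by omega⟩
      rw [show r + 1 + m = r + m + 1 by ring, truncBinomial_succ_succ, mul_add, map_add,
        mul_left_comm, coeff_succ_X_mul, Nat.choose_succ_succ]
      have h1 := ih (q + 1) (d + 1) h
      have h2 := ih q d (by omega)
      rw [Nat.add_sub_add_right] at h1 ⊢
      push_cast
      linarith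

theorem coeff_nonneg_of_choose_le {r m q : ℕ}
    (h : ∀ d, q + 1 ≤ d → r.choose d ≤ r.choose q * m.multichoose (d - q)) (d : ℕ) :
    0 ≤ coeff d ((mk 1) ^ m * numerator (r + m) q) := by
  rcases Nat.lt_or_ge q d with hd | hd
  · rw [coeff_mk_one_pow_mul_numerator]
    have h1 := choose_mul_multichoose_le_coeff r m q d hd
    have h2 : (r.choose d : ℤ) ≤ r.choose q * m.multichoose (d - q) := mod_cast h d hd
    rcases neg_one_pow_eq_or ℤ (d + q) with h3 | h3 <;> rw [h3] <;> linarith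
  · rw [coeff_mk_one_pow_mul_numerator_of_le _ _ hd]

theorem succ_mul_multichoose_succ (m d : ℕ) :
    (d + 1) * m.multichoose (d + 1) = (m + d) * m.multichoose d := by
  cases m with
  | zero => cases d <;> simp
  | succ m =>
    rw [Nat.multichoose_eq, Nat.multichoose_eq, show m + 1 + (d + 1) - 1 = m + d + 1 by omega,
      show m + 1 + d - 1 = m + d by omega, mul_comm, ← Nat.add_one_mul_choose_eq]
    ring

theorem multichoose_sub_le {m d j : ℕ} (hm : 1 ≤ m) (hj : j ≤ d) :
    (m.multichoose (d - j) : ℝ) ≤ (d / m : ℝ) ^ j * m.multichoose d := by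
  have hm' : (0 : ℝ) < m := by exact_mod_cast hm
  induction j with
  | zero => simp
  | succ j ih =>
    obtain ⟨e, he⟩ : ∃ e, d - j = e + 1 := ⟨d - j - 1, by omega⟩
    have h1 : ((e : ℝ) + 1) * m.multichoose (e + 1) = (m + e) * m.multichoose e := by
      exact_mod_cast succ_mul_multichoose_succ m e
    have h2 := ih (by omega)
    rw [he] at h2
    rw [show d - (j + 1) = e by omega, pow_succ', mul_assoc]
    have hed : ((e : ℝ) + 1) ≤ d := by exact_mod_cast (show e + 1 ≤ d by omega)
    have h3 : (m.multichoose e : ℝ) ≤ d / m * m.multichoose (e + 1) := by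
      rw [div_mul_eq_mul_div, le_div_iff₀ hm']
      have h4 : (0 : ℝ) ≤ m.multichoose e := by positivity
      have h5 : (0 : ℝ) ≤ m.multichoose (e + 1) := by positivity
      have h6 : (0 : ℝ) ≤ e := by positivity
      nlinarith
    exact h3.trans (by gcongr)

/-- The truncation has q + 1 monomials; raising the degree of a monomial by one costs at most a
factor n d / m. Since m ≤ n d this factor is at least 1, so the top power dominates every term. -/
theorem abs_coeff_truncBinomial_le {n m q d : ℕ} (hm : 1 ≤ m) (hq : q ≤ d) (hn : m ≤ n * d) :
    |((coeff d ((mk 1) ^ m * truncBinomial n q) : ℤ) : ℝ)| ≤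
      (q + 1) * ((n * d : ℝ) / m) ^ q * m.multichoose d := by
  have hm' : (0 : ℝ) < m := by exact_mod_cast hm
  have hone : 1 ≤ (n * d : ℝ) / m := by
    rw [le_div_iff₀ hm', one_mul]
    exact_mod_cast hn
  induction q with
  | zero => simp [truncBinomial, coeff_mk_one_pow]
  | succ q ih =>
    have h1 := ih (by omega)
    rw [truncBinomial, mul_sub, map_sub, ← map_natCast (PowerSeries.C (R := ℤ)), mul_left_comm,
      coeff_C_mul, coeff_mul_X_pow', if_pos hq, coeff_mk_one_pow]
    push_cast
    refine (abs_sub _ _).trans ?_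
    have h2 : |(n.choose (q + 1) : ℝ) * m.multichoose (d - (q + 1))| ≤
        ((n * d : ℝ) / m) ^ (q + 1) * m.multichoose d := by
      rw [abs_of_nonneg (by positivity), mul_div_assoc, mul_pow, mul_assoc]
      gcongr
      · exact_mod_cast Nat.choose_le_pow n (q + 1)
      · exact multichoose_sub_le hm hq
    have h3 : ((n * d : ℝ) / m) ^ q ≤ ((n * d : ℝ) / m) ^ (q + 1) :=
      pow_le_pow_right₀ hone (by omega)
    have h4 : ((q : ℝ) + 1) * ((n * d : ℝ) / m) ^ q * m.multichoose d ≤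
        ((q : ℝ) + 1) * ((n * d : ℝ) / m) ^ (q + 1) * m.multichoose d := by gcongr
    linarith

theorem choose_le_of_coeff_nonneg {r m q d : ℕ} (hm : 1 ≤ m) (hq : q ≤ d)
    (hn : m ≤ (r + m) * d) (hpar : Even (d + q))
    (h : 0 ≤ coeff d ((mk 1) ^ m * numerator (r + m) q)) :
    (r.choose d : ℝ) ≤ (q + 1) * (((r + m : ℕ) * d : ℝ) / m) ^ q * m.multichoose d := by
  rw [coeff_mk_one_pow_mul_numerator, hpar.neg_one_pow, one_mul, sub_nonneg] at h
  have h' : (r.choose d : ℝ) ≤ ((coeff d ((mk 1) ^ m * truncBinomial (r + m) q) : ℤ) : ℝ) := by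
    exact_mod_cast h
  exact h'.trans ((le_abs_self _).trans (abs_coeff_truncBinomial_le hm hq hn))

/-! ### Nonnegative series as sums of shifted Hilbert series of polynomial rings -/

theorem coeff_mk_one_mul_numerator {n q d : ℕ} (hq : q ≤ n) (hd : n + 1 ≤ d) :
    coeff d (mk 1 * numerator (n + 1) q) = (n.choose q : ℤ) := by
  have h := coeff_mk_one_pow_mul_numerator n 1 q d
  rw [pow_one, Nat.choose_eq_zero_of_lt (show n < d by omega)] at h
  rw [h]
  simp only [Nat.cast_zero, mul_zero, sub_zero]
  clear h
  induction q with
  | zero => simp [truncBinomial]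
  | succ q ih =>
    rw [truncBinomial, mul_sub, map_sub, ih (by omega), ← map_natCast (PowerSeries.C (R := ℤ)),
      mul_left_comm, coeff_C_mul, coeff_mul_X_pow', if_pos (by omega), coeff_mk,
      Nat.choose_succ_succ]
    simp

/-- One factor H makes the coefficients eventually equal to binom(n, q) > 0; each further factor
takes partial sums, which then increase without bound. -/
theorem eventually_coeff_pos {n q : ℕ} (hq : q ≤ n) (j : ℕ) :
    ∀ᶠ d in atTop, 1 ≤ coeff d ((mk 1) ^ (j + 1) * numerator (n + 1) q) := by
  induction j with
  | zero =>
    filter_upwards [eventually_ge_atTop (n + 1)] with d hd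
    rw [zero_add, pow_one, coeff_mk_one_mul_numerator hq hd]
    exact_mod_cast Nat.choose_pos hq
  | succ j ih =>
    obtain ⟨D, hD⟩ := eventually_atTop.mp ih
    have key : ∀ e : ℕ, coeff D ((mk 1) ^ (j + 1 + 1) * numerator (n + 1) q) + (e : ℤ) ≤
        coeff (D + e) ((mk 1) ^ (j + 1 + 1) * numerator (n + 1) q) := by
      intro e
      induction e with
      | zero => simp
      | succ e ihe =>
        rw [← add_assoc, pow_succ', mul_assoc, coeff_mk_one_mul_succ, ← mul_assoc, ← pow_succ']
        have := hD (D + e + 1) (by omega)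
        push_cast
        linarith
    -- The partial sum at D may be negative; since it grows by at least 1 per degree, this many
    -- steps lift it to 1.
    filter_upwards [eventually_ge_atTop
      (D + (1 - coeff D ((mk 1) ^ (j + 1 + 1) * numerator (n + 1) q)).toNat)] with d hd
    obtain ⟨e, rfl⟩ := Nat.exists_eq_add_of_le ((Nat.le_add_right _ _).trans hd)
    have h1 := key e
    have h2 := Int.self_le_toNat (1 - coeff D ((mk 1) ^ (j + 1 + 1) * numerator (n + 1) q))
    omega

/-- The part of a power series in degrees at least `D`. -/
noncomputable def tail (D : ℕ) (f : ℤ⟦X⟧) : ℤ⟦X⟧ := mk fun d => if D ≤ d then coeff d f else 0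

theorem eq_sum_add_tail (D : ℕ) (f : ℤ⟦X⟧) :
    f = ∑ d ∈ Finset.range D, coeff d f • X ^ d + tail D f := by
  ext e
  simp only [map_add, map_sum, map_zsmul, coeff_X_pow, tail, coeff_mk]
  by_cases h : D ≤ e
  · rw [Finset.sum_eq_zero, if_pos h, zero_add]
    intro d hd
    rw [if_neg (by have := Finset.mem_range.mp hd; omega), smul_zero]
  · rw [Finset.sum_eq_single_of_mem e (by simpa using h) (fun d _ hd => by simp [hd.symm])]
    simp [h]

/-- Partial sums beyond D start from the amount already accumulated at D, which enters as one extra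
monomial in degree D + 1. -/
theorem tail_mk_one_mul (D : ℕ) (f : ℤ⟦X⟧) :
    tail (D + 1) (mk 1 * f) =
      mk 1 * (tail (D + 1) f + coeff D (mk 1 * f) • X ^ (D + 1)) := by
  ext e
  induction e with
  | zero => simp [tail, coeff_zero_mk_one_mul]
  | succ e ih =>
    rw [coeff_mk_one_mul_succ, ← ih]
    simp only [tail, coeff_mk, map_add, map_zsmul, coeff_X_pow, coeff_mk_one_mul_succ]
    rcases lt_trichotomy e D with h | h | h
    · simp [show ¬ D ≤ e by omega, show ¬ D + 1 ≤ e by omega, h.ne]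
    · subst h
      simp
      ring
    · simp [show D ≤ e by omega, show D + 1 ≤ e by omega, h.ne']

/-- Sums of Hilbert series of shifted polynomial rings in at most `m` variables. -/
def hilbertCone (m : ℕ) : AddSubmonoid ℤ⟦X⟧ :=
  AddSubmonoid.closure {f | ∃ s e : ℕ, e ≤ m ∧ f = X ^ s * (mk 1) ^ e}

theorem X_pow_mul_mem_hilbertCone {m s e : ℕ} (he : e ≤ m) :
    (X ^ s * (mk 1) ^ e : ℤ⟦X⟧) ∈ hilbertCone m :=
  AddSubmonoid.subset_closure ⟨s, e, he, rfl⟩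

theorem zsmul_mem_hilbertCone {m s e : ℕ} (he : e ≤ m) {c : ℤ} (hc : 0 ≤ c) :
    c • (X ^ s * (mk 1) ^ e : ℤ⟦X⟧) ∈ hilbertCone m := by
  lift c to ℕ using hc
  rw [natCast_zsmul]
  exact nsmul_mem (X_pow_mul_mem_hilbertCone he) c

theorem mk_one_mul_mem_hilbertCone {m : ℕ} {f : ℤ⟦X⟧} (hf : f ∈ hilbertCone m) :
    mk 1 * f ∈ hilbertCone (m + 1) := by
  induction hf using AddSubmonoid.closure_induction with
  | mem f hf =>
    obtain ⟨s, e, he, rfl⟩ := hf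
    rw [mul_left_comm, ← pow_succ']
    exact X_pow_mul_mem_hilbertCone (by omega)
  | zero => simp
  | add f g _ _ hf hg => rw [mul_add]; exact add_mem hf hg

/-- Peeling off one factor H at a time leaves one monomial in degree D + 1 per step, with
coefficient the accumulated value at D, followed by the factors H already removed. -/
theorem tail_mem_hilbertCone {D m : ℕ} {f : ℤ⟦X⟧} (h0 : tail (D + 1) f = 0)
    (h : ∀ j < m, 0 ≤ coeff D ((mk 1) ^ (j + 1) * f)) :
    tail (D + 1) ((mk 1) ^ m * f) ∈ hilbertCone m := by
  induction m with
  | zero => simp [h0]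
  | succ m ih =>
    rw [pow_succ', mul_assoc, tail_mk_one_mul]
    refine mk_one_mul_mem_hilbertCone (add_mem (ih fun j hj => h j (by omega)) ?_)
    have := zsmul_mem_hilbertCone (Nat.zero_le m) (s := D + 1) (h m (by omega))
    rwa [pow_zero, mul_one, pow_succ', mul_assoc] at this

/-- Low degrees are covered by copies of K, the powers with e = 0. Past a large D the polynomial
`numerator` has ended and all iterated partial sums are positive, so the tail lies in the cone too.
-/
theorem mem_hilbertCone_of_nonneg {n q m : ℕ} (hq : q ≤ n)
    (h : ∀ d, 0 ≤ coeff d ((mk 1) ^ m * numerator (n + 1) q)) :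
    (mk 1) ^ m * numerator (n + 1) q ∈ hilbertCone m := by
  have hev : ∀ᶠ d in atTop, ∀ j ∈ Finset.range m,
      1 ≤ coeff d ((mk 1) ^ (j + 1) * numerator (n + 1) q) :=
    (Finset.eventually_all _).mpr fun j _ => eventually_coeff_pos hq j
  obtain ⟨D, hD, hDq⟩ := (hev.and (eventually_ge_atTop (n + q + 2))).exists
  have h0 : tail (D + 1) (numerator (n + 1) q) = 0 := by
    ext d
    simp only [tail, coeff_mk, coeff_numerator, map_zero]
    split_ifs with h1 h2
    · rfl
    · rw [Nat.choose_eq_zero_of_lt (by omega)]; simp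
    · rfl
  rw [eq_sum_add_tail (D + 1) ((mk 1) ^ m * numerator (n + 1) q)]
  refine add_mem (sum_mem fun d _ => ?_) (tail_mem_hilbertCone h0 fun j hj =>
    zero_le_one.trans (hD j (Finset.mem_range.mpr hj)))
  have := zsmul_mem_hilbertCone (Nat.zero_le m) (s := d) (h d)
  rwa [pow_zero, mul_one] at this

end Series

end HilbertDepth

namespace HilbertDepth

/-! ### Comparison of `r.choose e` with `m.multichoose e` for r = m + 2x -/

section Estimates

/-- The denominator Q stays fixed so that induction on q is possible; the case of interest is Q = q.
-/
theorem one_add_div_pow_le_choose {q Q : ℕ} (e : ℕ) (hQ : q ≤ Q) :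
    (1 + (e : ℝ) / Q) ^ q ≤ ((q + e).choose q : ℝ) := by
  induction q with
  | zero => simp
  | succ q ih =>
    have h1 := ih (by omega)
    have h2 : ((q + e + 1 : ℕ) : ℝ) * (q + e).choose q = (q + e + 1).choose (q + 1) * (q + 1 : ℕ) := by
      exact_mod_cast Nat.add_one_mul_choose_eq (q + e) q
    push_cast at h2
    have hQ' : ((q : ℝ) + 1) ≤ Q := by exact_mod_cast hQ
    have h3 : (e : ℝ) / Q ≤ e / (q + 1) := by gcongr
    have h4 : ((q + 1 + e).choose (q + 1) : ℝ) = (q + e).choose q * (1 + e / (q + 1)) := by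
      rw [show q + 1 + e = q + e + 1 by ring]
      field_simp
      linarith
    rw [h4, pow_succ]
    gcongr

theorem choose_succ_mul_eq {r e : ℕ} (h : e ≤ r) :
    (r.choose (e + 1) : ℝ) * (e + 1) = r.choose e * (r - e) := by
  rw [← Nat.cast_sub h]
  exact_mod_cast Nat.choose_succ_right_eq r e

theorem succ_mul_multichoose_succ_real (m e : ℕ) :
    ((e : ℝ) + 1) * m.multichoose (e + 1) = (m + e) * m.multichoose e := by
  exact_mod_cast succ_mul_multichoose_succ m e

/-- Consecutive quotients have ratio (r - e)/(m + e) ≤ exp((2x - 2e)/m) while e ≤ x; the exponents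
add up to (2xe - e² + e)/m. -/
theorem choose_le_exp_mul_multichoose {r m e : ℕ} {x : ℝ} (hm : 1 ≤ m) (hr : (r : ℝ) = m + 2 * x)
    (he : e ≤ x + 1) :
    (r.choose e : ℝ) ≤ Real.exp ((2 * x * e - e ^ 2 + e) / m) * m.multichoose e := by
  have hm' : (0 : ℝ) < m := by exact_mod_cast hm
  induction e with
  | zero => simp
  | succ e ih =>
    push_cast at he
    have hex : (e : ℝ) ≤ x := by linarith
    have he0 : (0 : ℝ) ≤ e := by positivity
    have h1 := ih (by linarith)
    have her : e ≤ r := by exact_mod_cast (show (e : ℝ) ≤ r by linarith)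
    have h2 := choose_succ_mul_eq her
    have h3 := succ_mul_multichoose_succ_real m e
    have h4 : (r : ℝ) - e ≤ (m + e) * Real.exp ((2 * x - 2 * e) / m) := by
      have h5 := Real.add_one_le_exp ((2 * x - 2 * e) / m)
      have h6 : (2 * x - 2 * e) ≤ (m + e) * ((2 * x - 2 * e) / m) := by
        rw [mul_div_assoc', le_div_iff₀ hm']
        nlinarith
      nlinarith
    have h7 : Real.exp ((2 * x * (e + 1 : ℕ) - (e + 1 : ℕ) ^ 2 + (e + 1 : ℕ)) / m) =
        Real.exp ((2 * x * e - e ^ 2 + e) / m) * Real.exp ((2 * x - 2 * e) / m) := by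
      rw [← Real.exp_add]
      congr 1
      push_cast
      ring
    refine le_of_mul_le_mul_right ?_ (show (0 : ℝ) < e + 1 by positivity)
    calc (r.choose (e + 1) : ℝ) * (e + 1) = r.choose e * (r - e) := h2
      _ ≤ (Real.exp ((2 * x * e - e ^ 2 + e) / m) * m.multichoose e) *
          ((m + e) * Real.exp ((2 * x - 2 * e) / m)) := by
        gcongr
        linarith
      _ = _ := by
        rw [h7]
        linear_combination -(Real.exp ((2 * x * e - e ^ 2 + e) / m) *
          Real.exp ((2 * x - 2 * e) / m)) * h3

theorem mul_log_one_add_le {t s : ℝ} (ht : 0 ≤ t) (ht1 : t ≤ 1) (hs : 0 ≤ s) :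
    t * Real.log (1 + s) ≤ Real.log (1 + t * s) := by
  rw [← Real.log_rpow (by linarith)]
  exact Real.log_le_log (by positivity)
    (rpow_one_add_le_one_add_mul_self (by linarith) ht ht1)

theorem choose_le_multichoose_mul_choose_of_le {r m q e : ℕ} {x : ℝ} (hq : 1 ≤ q) (hm : 1 ≤ m)
    (hr : (r : ℝ) = m + 2 * x) (hx : 1 ≤ x)
    (h : (x ^ 2 + x + 1) / m ≤ q * Real.log (1 + x / (2 * q))) (he : 1 ≤ e)
    (hex : e ≤ x + 1) :
    r.choose e ≤ m.multichoose e * (q + e).choose q := by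
  have hm' : (0 : ℝ) < m := by exact_mod_cast hm
  have hq' : (0 : ℝ) < q := by exact_mod_cast hq
  have he' : (1 : ℝ) ≤ e := by exact_mod_cast he
  have key : (2 * x * e - e ^ 2 + e) / m ≤ q * Real.log (1 + e / q) := by
    -- Below x/2, concavity of the logarithm interpolates linearly between e = 0 and e = x/2. Above
    -- x/2, the left side is at most its peak and the logarithm at least its value at x/2. The
    -- hypothesis `h` compares these two extremes.
    rcases le_total (2 * (e : ℝ)) x with h1 | h1
    · have h2 : 2 * e / x ≤ 1 := by rw [div_le_one (by linarith)]; exact h1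
      have h3 := mul_log_one_add_le (t := 2 * e / x) (s := x / (2 * q)) (by positivity) h2
        (by positivity)
      have h4 : 2 * e / x * (x / (2 * q)) = e / q := by field_simp
      rw [h4] at h3
      calc (2 * x * e - e ^ 2 + e) / m ≤ 2 * e / x * ((x ^ 2 + x + 1) / m) := by
            rw [mul_div_assoc']
            gcongr
            rw [div_mul_eq_mul_div, le_div_iff₀ (by linarith)]
            nlinarith
        _ ≤ 2 * e / x * (q * Real.log (1 + x / (2 * q))) := by gcongr
        _ = q * (2 * e / x * Real.log (1 + x / (2 * q))) := by ring
        _ ≤ _ := by gcongr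
    · refine le_trans ?_ (h.trans ?_)
      · refine div_le_div_of_nonneg_right ?_ hm'.le
        nlinarith [sq_nonneg (x - e)]
      · gcongr q * Real.log (1 + ?_)
        rw [div_le_div_iff₀ (by positivity) hq']
        nlinarith
  have h1 := choose_le_exp_mul_multichoose hm hr hex
  have h2 : Real.exp ((2 * x * e - e ^ 2 + e) / m) ≤ ((q + e).choose q : ℝ) := by
    refine (Real.exp_le_exp.mpr key).trans (le_trans (le_of_eq ?_)
      (one_add_div_pow_le_choose e le_rfl))
    rw [← Real.log_pow, Real.exp_log (by positivity)]
  have h3 : (r.choose e : ℝ) ≤ m.multichoose e * (q + e).choose q := by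
    rw [mul_comm]
    exact h1.trans (by gcongr)
  exact_mod_cast h3

/-- Once e ≥ x the ratio (r - e)/(m + e) is at most 1, so the inequality, known up to the peak,
propagates. -/
theorem choose_le_multichoose_mul_choose {r m q : ℕ} {x : ℝ} (hq : 1 ≤ q) (hm : 1 ≤ m)
    (hr : (r : ℝ) = m + 2 * x) (hx : 1 ≤ x)
    (h : (x ^ 2 + x + 1) / m ≤ q * Real.log (1 + x / (2 * q))) {e : ℕ} (he : 1 ≤ e) :
    r.choose e ≤ m.multichoose e * (q + e).choose q := by
  induction e, he using Nat.le_induction with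
  | base =>
    exact choose_le_multichoose_mul_choose_of_le hq hm hr hx h le_rfl (by push_cast; linarith)
  | succ e he ih =>
    rcases le_total (e : ℝ) x with hex | hex
    · exact choose_le_multichoose_mul_choose_of_le hq hm hr hx h (by omega)
        (by push_cast; linarith)
    · have h1 : r ≤ m + 2 * e := by
        exact_mod_cast (show (r : ℝ) ≤ m + 2 * e by linarith)
      have h2 := Nat.choose_succ_right_eq r e
      have h3 := succ_mul_multichoose_succ m e
      have h4 : (q + e).choose q ≤ (q + (e + 1)).choose q := Nat.choose_le_choose q (by omega)
      refine Nat.le_of_mul_le_mul_right ?_ (show 0 < e + 1 by omega)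
      calc r.choose (e + 1) * (e + 1) = r.choose e * (r - e) := h2
        _ ≤ (m.multichoose e * (q + e).choose q) * (m + e) :=
          Nat.mul_le_mul ih (by omega)
        _ = ((e + 1) * m.multichoose (e + 1)) * (q + e).choose q := by rw [h3]; ring
        _ ≤ ((e + 1) * m.multichoose (e + 1)) * (q + (e + 1)).choose q :=
          Nat.mul_le_mul_left _ h4
        _ = _ := by ring

theorem choose_le_multichoose {r m : ℕ} (h : r ≤ m) (e : ℕ) :
    r.choose e ≤ m.multichoose e := by
  rw [Nat.multichoose_eq]
  cases e with
  | zero => simp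
  | succ e => exact Nat.choose_le_choose _ (by omega)

/-- With d = q + e, the identity binom(r, d) binom(d, q) = binom(r, q) binom(r - q, e) lets binom(d,
q) be cancelled; this factor is the polynomial gain that grows with q. -/
theorem coeff_nonneg_of_choose_le_multichoose_mul {r m q : ℕ}
    (h : ∀ e, 1 ≤ e → r.choose e ≤ m.multichoose e * (q + e).choose q) (d : ℕ) :
    0 ≤ PowerSeries.coeff d ((PowerSeries.mk 1) ^ m * numerator (r + m) q) := by
  refine coeff_nonneg_of_choose_le (fun d hd => ?_) d
  obtain ⟨e, rfl⟩ := Nat.exists_eq_add_of_le (show q ≤ d by omega)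
  rw [Nat.add_sub_cancel_left]
  have h1 := h e (by omega)
  rcases Nat.lt_or_ge r (q + e) with hr | hr
  · simp [Nat.choose_eq_zero_of_lt hr]
  · have h2 := Nat.choose_mul (n := r) (Nat.le_add_right q e)
    rw [Nat.add_sub_cancel_left] at h2
    refine Nat.le_of_mul_le_mul_right ?_ (Nat.choose_pos (Nat.le_add_right q e))
    calc r.choose (q + e) * (q + e).choose q = r.choose q * (r - q).choose e := h2
      _ ≤ r.choose q * r.choose e := Nat.mul_le_mul_left _ (Nat.choose_le_choose _ (by omega))
      _ ≤ r.choose q * (m.multichoose e * (q + e).choose q) := Nat.mul_le_mul_left _ h1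
      _ = _ := by ring

/-- The converse step estimate is log y ≥ 1 - 1/y at y = (r - e)/(m + e), which gives (2x - 2e)/(r -
e) ≥ (2x - 2e)/r. -/
theorem exp_mul_multichoose_le_choose {r m e : ℕ} {x : ℝ} (hm : 1 ≤ m)
    (hr : (r : ℝ) = m + 2 * x) (he : e ≤ x) :
    Real.exp ((2 * x * e - e ^ 2 + e) / r) * m.multichoose e ≤ r.choose e := by
  have hm' : (0 : ℝ) < m := by exact_mod_cast hm
  have hx : 0 ≤ x := le_trans (by positivity) he
  have hr' : (0 : ℝ) < r := by linarith
  induction e with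
  | zero => simp
  | succ e ih =>
    push_cast at he
    have he0 : (0 : ℝ) ≤ e := by positivity
    have h1 := ih (by linarith)
    have her : e ≤ r := by exact_mod_cast (show (e : ℝ) ≤ r by linarith)
    have h2 := choose_succ_mul_eq her
    have h3 := succ_mul_multichoose_succ_real m e
    have hre : (0 : ℝ) < r - e := by linarith
    have h4 : (m + e) * Real.exp ((2 * x - 2 * e) / r) ≤ (r : ℝ) - e := by
      have h5 : Real.exp ((2 * x - 2 * e) / r) ≤ ((r : ℝ) - e) / (m + e) := by
        rw [← Real.le_log_iff_exp_le (by positivity)]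
        refine le_trans ?_ (Real.one_sub_inv_le_log_of_pos (by positivity))
        rw [inv_div, one_sub_div hre.ne']
        rw [show (r : ℝ) - e - (m + e) = 2 * x - 2 * e by linarith]
        gcongr <;> linarith
      rwa [le_div_iff₀ (by positivity), mul_comm] at h5
    have h7 : Real.exp ((2 * x * (e + 1 : ℕ) - (e + 1 : ℕ) ^ 2 + (e + 1 : ℕ)) / r) =
        Real.exp ((2 * x * e - e ^ 2 + e) / r) * Real.exp ((2 * x - 2 * e) / r) := by
      rw [← Real.exp_add]
      congr 1
      push_cast
      ring
    refine le_of_mul_le_mul_right ?_ (show (0 : ℝ) < e + 1 by positivity)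
    have h8 : Real.exp ((2 * x * (e + 1 : ℕ) - (e + 1 : ℕ) ^ 2 + (e + 1 : ℕ)) / r) *
        m.multichoose (e + 1) * (e + 1) =
        (Real.exp ((2 * x * e - e ^ 2 + e) / r) * m.multichoose e) *
          ((m + e) * Real.exp ((2 * x - 2 * e) / r)) := by
      rw [h7]
      linear_combination (Real.exp ((2 * x * e - e ^ 2 + e) / r) *
        Real.exp ((2 * x - 2 * e) / r)) * h3
    rw [h8, h2]
    gcongr

theorem log_bound_of_coeff_nonneg {r m q : ℕ} {x : ℝ} (hm : 1 ≤ m)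
    (hr : (r : ℝ) = m + 2 * x) (hx : q + 3 ≤ x)
    (h : ∀ d, 0 ≤ PowerSeries.coeff d ((PowerSeries.mk 1) ^ m * numerator (r + m) q)) :
    (x ^ 2 - 4) / r ≤ Real.log (q + 1) + q * Real.log ((r + m) * x / m) := by
  have hm' : (0 : ℝ) < m := by exact_mod_cast hm
  have hq0 : (0 : ℝ) ≤ q := by positivity
  have hr' : (0 : ℝ) < r := by linarith
  -- The test degree sits next to the peak, with the parity that makes binom(r, d) enter negatively.
  -- As x - d ≤ 2, the exponent loses at most 4 against x².
  obtain ⟨d, hdx, hxd, hpar⟩ : ∃ d : ℕ, (d : ℝ) ≤ x ∧ x ≤ d + 2 ∧ Even (d + q) := by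
    have h1 := Nat.floor_le (show 0 ≤ x by linarith)
    have h2 := (Nat.lt_floor_add_one x).le
    rcases Nat.even_or_odd (⌊x⌋₊ + q) with hp | hp
    · exact ⟨⌊x⌋₊, h1, by linarith, hp⟩
    · have h3 : 1 ≤ ⌊x⌋₊ := Nat.le_floor (by push_cast; linarith)
      refine ⟨⌊x⌋₊ - 1, ?_, ?_, ?_⟩
      · push_cast [h3]; linarith
      · push_cast [h3]; linarith
      · rw [show ⌊x⌋₊ + q = (⌊x⌋₊ - 1 + q) + 1 by omega, Nat.odd_add_one] at hp
        simpa using hp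
  have hqd : q + 1 ≤ d := by
    exact_mod_cast (show (q : ℝ) + 1 ≤ d by linarith)
  have hd0 : (0 : ℝ) < d := by exact_mod_cast (show 0 < d by omega)
  have h1 := choose_le_of_coeff_nonneg hm (show q ≤ d by omega)
    (show m ≤ (r + m) * d by nlinarith) hpar (h d)
  have h2 := exp_mul_multichoose_le_choose hm hr hdx
  have h3 : (0 : ℝ) < m.multichoose d := by
    have : 0 < m.multichoose d := by
      rw [Nat.multichoose_eq]; exact Nat.choose_pos (by omega)
    exact_mod_cast this
  have h4 := le_of_mul_le_mul_right (h2.trans h1) h3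
  have h5 : (x ^ 2 - 4) / r ≤ (2 * x * d - d ^ 2 + d) / r := by
    gcongr
    nlinarith
  have h6 : Real.exp ((x ^ 2 - 4) / r) ≤ (q + 1) * ((r + m) * x / m) ^ q := by
    refine (Real.exp_le_exp.mpr h5).trans (h4.trans ?_)
    push_cast
    gcongr
  have h7 : 0 < (r + m : ℝ) * x / m := by
    have : 0 < x := by linarith
    positivity
  rw [← Real.le_log_iff_exp_le (by positivity), Real.log_mul (by positivity) (by positivity),
    Real.log_pow] at h6
  exact h6

end Estimates
end HilbertDepth

namespace HilbertDepth

section Limits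

/-! ### Asymptotics of the threshold equation q log z = 2z²/t -/

open Real Topology

/-- A two-term expansion whose main term is a multiple of `√(t log t)`. -/
noncomputable def expansion (a c t : ℝ) : ℝ := √(t / log t) * (a * log t + c * log (log t))

theorem tendsto_log_log : Tendsto (fun t : ℝ => log (log t)) atTop atTop :=
  tendsto_log_atTop.comp tendsto_log_atTop

theorem tendsto_log_log_pow_div_log (k : ℕ) :
    Tendsto (fun t : ℝ => log (log t) ^ k / log t) atTop (𝓝 0) :=
  ((isLittleO_pow_log_id_atTop (n := k)).tendsto_div_nhds_zero).comp tendsto_log_atTop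

theorem tendsto_const_add_log_log_div_log (a c : ℝ) :
    Tendsto (fun t : ℝ => a + c * (log (log t) / log t)) atTop (𝓝 a) := by
  have h := ((tendsto_log_log_pow_div_log 1).const_mul c).const_add a
  simpa using h

theorem expansion_eq (a c : ℝ) {t : ℝ} (ht : 1 < t) :
    expansion a c t = √t * √(log t) * (a + c * (log (log t) / log t)) := by
  have hL : 0 < log t := log_pos ht
  have h1 : log t = √(log t) * √(log t) := (mul_self_sqrt hL.le).symm
  have h2 : √(log t) ≠ 0 := (sqrt_pos.mpr hL).ne'
  rw [expansion, sqrt_div' t hL.le]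
  have h3 : a * log t + c * log (log t) = log t * (a + c * (log (log t) / log t)) := by
    field_simp
  rw [h3]
  nth_rewrite 2 [h1]
  field_simp

theorem tendsto_expansion {a : ℝ} (ha : 0 < a) (c : ℝ) :
    Tendsto (expansion a c) atTop atTop := by
  have h1 : Tendsto (fun t : ℝ => √t * √(log t)) atTop atTop :=
    tendsto_sqrt_atTop.atTop_mul_atTop₀ (tendsto_sqrt_atTop.comp tendsto_log_atTop)
  refine (h1.atTop_mul_pos ha (tendsto_const_add_log_log_div_log a c)).congr' ?_
  filter_upwards [eventually_gt_atTop 1] with t ht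
  exact (expansion_eq a c ht).symm

theorem tendsto_sqrt_log_pow_div (k : ℕ) : Tendsto (fun t : ℝ => √(log t ^ k / t)) atTop (𝓝 0) := by
  have h := (isLittleO_pow_log_id_atTop (n := k)).tendsto_div_nhds_zero
  simpa using h.sqrt

theorem tendsto_expansion_div (a c : ℝ) :
    Tendsto (fun t => expansion a c t / t) atTop (𝓝 0) := by
  have h := (tendsto_sqrt_log_pow_div 1).mul (tendsto_const_add_log_log_div_log a c)
  rw [zero_mul] at h
  refine h.congr' ?_
  filter_upwards [eventually_gt_atTop 1] with t ht
  have ht0 : 0 < t := by linarith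
  have h1 : t = √t * √t := (mul_self_sqrt ht0.le).symm
  have h2 : √t ≠ 0 := (sqrt_pos.mpr ht0).ne'
  rw [expansion_eq a c ht, pow_one, sqrt_div' _ ht0.le]
  field_simp
  rw [sq_sqrt ht0.le]
  ring

/-- This controls the cost of replacing denominators n/2 ± z by n/2 in z²/(n/2 ± z). -/
theorem tendsto_expansion_pow_three_div (a c : ℝ) :
    Tendsto (fun t => expansion a c t ^ 3 / t ^ 2) atTop (𝓝 0) := by
  have h := (tendsto_sqrt_log_pow_div 3).mul ((tendsto_const_add_log_log_div_log a c).pow 3)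
  rw [zero_mul] at h
  refine h.congr' ?_
  filter_upwards [eventually_gt_atTop 1] with t ht
  have ht0 : 0 < t := by linarith
  have hL : 0 < log t := log_pos ht
  have h1 : t = √t * √t := (mul_self_sqrt ht0.le).symm
  have h2 : √t ≠ 0 := (sqrt_pos.mpr ht0).ne'
  have h3 : √(log t ^ 3) = √(log t) ^ 3 := by
    rw [sqrt_eq_iff_mul_self_eq (by positivity) (by positivity)]
    rw [show √(log t) ^ 3 * √(log t) ^ 3 = (√(log t) ^ 2) ^ 3 by ring, sq_sqrt hL.le]
  rw [expansion_eq a c ht, sqrt_div' _ ht0.le, h3, mul_pow, mul_pow]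
  rw [div_mul_eq_mul_div, div_eq_div_iff h2 (by positivity)]
  linear_combination (√(log t) ^ 3 * (a + c * (log (log t) / log t)) ^ 3 * (t + √t ^ 2)) * h1

/-- The choice q = 4a² cancels the log t terms. The coefficient of log log t changes sign at c =
q/(8a), which is √q/4 for a = √q/2; this is the source of the second-order constant. -/
theorem mul_log_expansion_sub {a : ℝ} (c : ℝ) {q t : ℝ} (hq : q = 4 * a ^ 2)
    (ht : 1 < t) (hu : 0 < a + c * (log (log t) / log t)) :
    q * log (expansion a c t) - 2 * expansion a c t ^ 2 / t =
      (q / 2 - 4 * a * c) * log (log t) + (q * log (a + c * (log (log t) / log t)) -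
        2 * c ^ 2 * (log (log t) ^ 2 / log t)) := by
  have ht0 : 0 < t := by linarith
  have hL : 0 < log t := log_pos ht
  have h1 : log (expansion a c t) =
      (log t + log (log t)) / 2 + log (a + c * (log (log t) / log t)) := by
    rw [expansion_eq a c ht, log_mul (by positivity) hu.ne', log_mul (by positivity)
      (by positivity), log_sqrt ht0.le, log_sqrt hL.le]
    ring
  have h2 : expansion a c t ^ 2 / t = log t * (a + c * (log (log t) / log t)) ^ 2 := by
    rw [expansion_eq a c ht, mul_pow, mul_pow, sq_sqrt ht0.le, sq_sqrt hL.le]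
    field_simp
  rw [h1, mul_div_assoc, h2, hq]
  field_simp
  ring

theorem tendsto_log_expansion_remainder {a : ℝ} (ha : 0 < a) (c q : ℝ) :
    Tendsto (fun t : ℝ => q * log (a + c * (log (log t) / log t)) -
        2 * c ^ 2 * (log (log t) ^ 2 / log t)) atTop (𝓝 (q * log a - 2 * c ^ 2 * 0)) :=
  (((tendsto_const_add_log_log_div_log a c).log ha.ne').const_mul q).sub
    ((tendsto_log_log_pow_div_log 2).const_mul _)

theorem mul_log_expansion_sub_eventuallyEq {a : ℝ} (ha : 0 < a) (c : ℝ) {q : ℝ}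
    (hq : q = 4 * a ^ 2) :
    (fun t => (q / 2 - 4 * a * c) * log (log t) + (q * log (a + c * (log (log t) / log t)) -
        2 * c ^ 2 * (log (log t) ^ 2 / log t))) =ᶠ[atTop]
      fun t => q * log (expansion a c t) - 2 * expansion a c t ^ 2 / t := by
  filter_upwards [eventually_gt_atTop 1,
    (tendsto_const_add_log_log_div_log a c).eventually_const_lt ha] with t ht hu
  exact (mul_log_expansion_sub c hq ht hu).symm

theorem tendsto_mul_log_expansion_sub_atTop {a c q : ℝ} (ha : 0 < a) (hq : q = 4 * a ^ 2)
    (hc : 0 < q / 2 - 4 * a * c) :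
    Tendsto (fun t => q * log (expansion a c t) - 2 * expansion a c t ^ 2 / t) atTop atTop :=
  ((tendsto_log_log.const_mul_atTop hc).atTop_add
    (tendsto_log_expansion_remainder ha c q)).congr' (mul_log_expansion_sub_eventuallyEq ha c hq)

theorem tendsto_mul_log_expansion_sub_atBot {a c q : ℝ} (ha : 0 < a) (hq : q = 4 * a ^ 2)
    (hc : q / 2 - 4 * a * c < 0) :
    Tendsto (fun t => q * log (expansion a c t) - 2 * expansion a c t ^ 2 / t) atTop atBot :=
  ((tendsto_log_log.const_mul_atTop_of_neg hc).atBot_add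
    (tendsto_log_expansion_remainder ha c q)).congr' (mul_log_expansion_sub_eventuallyEq ha c hq)

theorem tendsto_sqrt_div_log_mul_log_log :
    Tendsto (fun t : ℝ => √(t / log t) * log (log t)) atTop atTop := by
  refine Tendsto.atTop_mul_atTop₀ ?_ tendsto_log_log
  refine tendsto_sqrt_atTop.comp ?_
  have h := (isLittleO_log_id_atTop).tendsto_div_nhds_zero
  have h2 : Tendsto (fun t : ℝ => log t / t) atTop (𝓝[>] 0) := by
    refine tendsto_nhdsWithin_iff.mpr ⟨h, ?_⟩
    filter_upwards [eventually_gt_atTop 1] with t ht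
    exact div_pos (log_pos ht) (by linarith)
  refine h2.inv_tendsto_nhdsGT_zero.congr fun t => ?_
  simp

end Limits

/-! ### From coefficient signs to the asymptotic expansion -/

section Threshold

theorem coeff_nonneg_of_log_bound {n q : ℕ} {z : ℝ} (hq : 1 ≤ q) (hz : 4 ≤ z) (hzn : z ≤ n / 8)
    (hz3 : z ^ 3 / n ^ 2 ≤ 1)
    (h : 9 + q * Real.log (4 * q) ≤ q * Real.log z - 2 * z ^ 2 / n) :
    ∃ r ≤ n, n / 2 + z ≤ r + 1 ∧
      ∀ d, 0 ≤ PowerSeries.coeff d ((PowerSeries.mk 1) ^ (n - r) * numerator n q) := by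
  have hq' : (0 : ℝ) < q := by exact_mod_cast hq
  have hn : (0 : ℝ) < n := by linarith
  set r := ⌊(n : ℝ) / 2 + z⌋₊ with hr
  have hr1 : (r : ℝ) ≤ n / 2 + z := Nat.floor_le (by linarith)
  have hr2 : n / 2 + z < (r : ℝ) + 1 := Nat.lt_floor_add_one _
  have hrn : r ≤ n := by exact_mod_cast (show (r : ℝ) ≤ n by linarith)
  refine ⟨r, hrn, hr2.le, ?_⟩
  set m := n - r with hm
  have hnm : n = r + m := by omega
  have hmr : (m : ℝ) = n - r := by rw [hm]; push_cast [hrn]; ring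
  have hm0 : n / 4 ≤ (m : ℝ) := by linarith
  set x : ℝ := r - n / 2 with hx
  have hx1 : x ≤ z := by linarith
  have hx2 : z - 1 < x := by linarith
  rw [hnm]
  refine coeff_nonneg_of_choose_le_multichoose_mul fun e he =>
    choose_le_multichoose_mul_choose hq (by exact_mod_cast (show (0 : ℝ) < m by linarith))
      (x := x) (by linarith) (by linarith) ?_ he
  -- Here m = n/2 - x. The bound z³ ≤ n² then turns n/2 - z into n/2 at the price of an additive
  -- constant, for which 9 is ample.
  have h1 : (x ^ 2 + x + 1) / m ≤ (z ^ 2 + z + 1) / (n / 2 - z) := by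
    gcongr <;> linarith
  have h2 : (z ^ 2 + z + 1) / (n / 2 - z) ≤ 2 * z ^ 2 / n + 9 := by
    have h3 : z ^ 3 ≤ n ^ 2 := by rwa [div_le_one (by positivity)] at hz3
    rw [div_le_iff₀ (by linarith)]
    have h4 : (2 * z ^ 2 / n + 9) * (n / 2 - z) = z ^ 2 + 9 * (n / 2 - z) - 2 * (z ^ 3 / n) := by
      field_simp
      ring
    have h5 : z ^ 3 / n ≤ n := by
      rw [div_le_iff₀ hn]; linarith
    rw [h4]
    linarith
  -- As z ≥ 4, rounding keeps x ≥ z - 1 ≥ z/2; this gives the constant 4q.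
  have h6 : q * Real.log z - q * Real.log (4 * q) ≤ q * Real.log (1 + x / (2 * q)) := by
    rw [← mul_sub, ← Real.log_div (by linarith) (by positivity)]
    gcongr
    have h7 : z / (4 * q) ≤ x / (2 * q) := by
      rw [div_le_div_iff₀ (by positivity) (by positivity)]
      nlinarith
    linarith
  linarith

theorem le_of_coeff_nonneg {n q r : ℕ} {z : ℝ} (hqz : q + 3 ≤ z) (hzn : z ≤ n / 8)
    (hz3 : z ^ 3 / n ^ 2 ≤ 1)
    (h : q * Real.log z - 2 * z ^ 2 / n < -(16 + Real.log (q + 1) + q * Real.log 8)) (hrn : r ≤ n)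
    (hr : ∀ d, 0 ≤ PowerSeries.coeff d ((PowerSeries.mk 1) ^ (n - r) * numerator n q)) :
    (r : ℝ) ≤ n / 2 + z := by
  by_contra! hlt
  have hq0 : (0 : ℝ) ≤ q := by positivity
  have hn : (0 : ℝ) < n := by linarith
  set s := ⌈(n : ℝ) / 2 + z⌉₊ with hs
  have hs1 : n / 2 + z ≤ (s : ℝ) := Nat.le_ceil _
  have hs2 : (s : ℝ) < n / 2 + z + 1 := Nat.ceil_lt_add_one (by linarith)
  have hsr : s ≤ r := Nat.ceil_le.mpr hlt.le
  set m := n - s with hm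
  have hnm : n = s + m := by omega
  have hmr : (m : ℝ) = n - s := by rw [hm]; push_cast [hsr.trans hrn]; ring
  have hm0 : n / 4 ≤ (m : ℝ) := by linarith
  set x : ℝ := s - n / 2 with hx
  -- Nonnegativity descends from r to s ≤ r, because multiplying by H preserves it. So only the
  -- first integer past n/2 + z needs to be excluded.
  have hs' : ∀ d, 0 ≤ PowerSeries.coeff d ((PowerSeries.mk 1) ^ m * numerator (s + m) q) := by
    rw [← hnm, show m = (r - s) + (n - r) by omega]
    intro d
    rw [pow_add, mul_assoc]
    exact coeff_mk_one_pow_mul_nonneg hr _ d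
  have h1 := log_bound_of_coeff_nonneg (x := x)
    (by exact_mod_cast (show (0 : ℝ) < m by linarith)) (by linarith) (by linarith) hs'
  have h2 : (s + m : ℝ) * x / m ≤ 8 * z := by
    rw [div_le_iff₀ (by linarith)]
    nlinarith
  have h3 : Real.log ((s + m : ℝ) * x / m) ≤ Real.log 8 + Real.log z := by
    rw [← Real.log_mul (by norm_num) (by linarith)]
    refine Real.log_le_log ?_ h2
    have : 0 < x := by linarith
    have : 0 < (m : ℝ) := by linarith
    positivity
  have h4 : 2 * z ^ 2 / n - 16 ≤ (x ^ 2 - 4) / s := by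
    have h5 : z ^ 3 ≤ n ^ 2 := by rwa [div_le_one (by positivity)] at hz3
    rw [le_div_iff₀ (by linarith)]
    have hzx : z ^ 2 ≤ x ^ 2 := by
      have : z ≤ x := by linarith
      have : 0 ≤ z := by linarith
      gcongr
    rcases le_total (2 * z ^ 2 / n - 16) 0 with h6 | h6
    · have : (2 * z ^ 2 / n - 16) * s ≤ 0 := mul_nonpos_of_nonpos_of_nonneg h6 (by positivity)
      nlinarith
    · have h7 : (2 * z ^ 2 / n - 16) * s ≤ (2 * z ^ 2 / n - 16) * (n / 2 + z + 1) := by gcongr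
      have h8 : (2 * z ^ 2 / n - 16) * (n / 2 + z + 1) =
          z ^ 2 + 2 * (z ^ 3 / n) + 2 * (z ^ 2 / n) - 16 * (n / 2 + z + 1) := by
        field_simp
      have h9 : z ^ 3 / n ≤ n := by
        rw [div_le_iff₀ hn]; linarith
      have h10 : z ^ 2 / n ≤ z := by
        rw [div_le_iff₀ hn]; nlinarith
      linarith
  have h11 : (q : ℝ) * Real.log ((s + m : ℝ) * x / m) ≤ q * (Real.log 8 + Real.log z) := by
    gcongr
  linarith

theorem isLittleO_of_criterion {q : ℕ} {f : ℕ → ℕ}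
    (hf : ∀ n, q + 1 ≤ n → ∀ r, r ≤ f n ↔ r ≤ n ∧
      ∀ d, 0 ≤ PowerSeries.coeff d ((PowerSeries.mk 1) ^ (n - r) * numerator n q)) :
    (fun n : ℕ => (f n : ℝ) -
          ((1 / 2 : ℝ) * (n : ℝ)
            + (1 / 2 : ℝ) * Real.sqrt ((q : ℝ) * (n : ℝ) * Real.log (n : ℝ))
            + (1 / 4 : ℝ) * Real.sqrt ((q : ℝ) * (n : ℝ) / Real.log (n : ℝ))
                * Real.log (Real.log (n : ℝ))))
      =o[atTop]
        (fun n : ℕ => Real.sqrt ((n : ℝ) / Real.log (n : ℝ)) * Real.log (Real.log (n : ℝ))) := by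
  have hw := tendsto_sqrt_div_log_mul_log_log.comp (tendsto_natCast_atTop_atTop (R := ℝ))
  rw [isLittleO_iff]
  intro ε hε
  -- Half of the ε budget absorbs rounding errors of size 1; the other half goes to shifting c by
  -- ε/2.
  have hw1 : ∀ᶠ n : ℕ in atTop, 2 / ε ≤ √((n : ℝ) / Real.log n) * Real.log (Real.log n) :=
    hw.eventually_ge_atTop _
  rcases Nat.eq_zero_or_pos q with rfl | hq
  · filter_upwards [hw1, eventually_ge_atTop 2] with n hn hn2
    rw [div_le_iff₀ hε] at hn
    have hlow : n / 2 ≤ f n := by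
      refine (hf n (by omega) _).mpr ⟨by omega, ?_⟩
      have h1 := coeff_nonneg_of_choose_le_multichoose_mul (r := n / 2) (m := n - n / 2) (q := 0)
        (fun e _ => by simpa using choose_le_multichoose (by omega) e)
      rwa [show n / 2 + (n - n / 2) = n by omega] at h1
    have hup : f n ≤ n / 2 + 1 := by
      by_contra! hlt
      obtain ⟨hle, hpos⟩ := (hf n (by omega) (n / 2 + 2)).mp hlt
      -- For q = 0 the coefficient in degree 2 is binom(m + 1, 2) - binom(r, 2), which is negative
      -- once r ≥ m + 2.
      have h1 := hpos 2
      obtain ⟨r, hr⟩ : ∃ r, r = n / 2 + 2 := ⟨_, rfl⟩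
      rw [← hr] at h1 hle
      obtain ⟨m, hm⟩ := Nat.exists_eq_add_of_le hle
      rw [hm, Nat.add_sub_cancel_left, coeff_mk_one_pow_mul_numerator, truncBinomial, mul_one,
        coeff_mk_one_pow, Nat.multichoose_eq] at h1
      have h2 : (m + 2 - 1).choose 2 < r.choose 2 :=
        lt_of_lt_of_le (by simp [Nat.choose_succ_succ]) (Nat.choose_le_choose 2
          (show m + 2 ≤ r by omega))
      have h3 : ((m + 2 - 1).choose 2 : ℤ) < r.choose 2 := by exact_mod_cast h2
      simp at h1 h3
      omega
    have h1 : (n : ℝ) ≤ 2 * (f n) + 1 := by exact_mod_cast (show n ≤ 2 * f n + 1 by omega)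
    have h2 : 2 * (f n : ℝ) ≤ n + 2 := by exact_mod_cast (show 2 * f n ≤ n + 2 by omega)
    rw [Real.norm_eq_abs, Real.norm_of_nonneg (by nlinarith), abs_le]
    simp only [CharP.cast_eq_zero, zero_mul, Real.sqrt_zero, mul_zero, add_zero, zero_div]
    constructor <;> linarith
  · have hq' : (0 : ℝ) < q := by exact_mod_cast hq
    have ha : 0 < √(q : ℝ) / 2 := by positivity
    have hqa : (q : ℝ) = 4 * (√(q : ℝ) / 2) ^ 2 := by
      rw [div_pow, Real.sq_sqrt hq'.le]; ring
    have hev : ∀ c : ℝ, ∀ᶠ n : ℕ in atTop,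
        (q + 4 ≤ expansion (√(q : ℝ) / 2) c n) ∧ (expansion (√(q : ℝ) / 2) c n ≤ n / 8) ∧
        (expansion (√(q : ℝ) / 2) c n ^ 3 / n ^ 2 ≤ 1) := by
      intro c
      have h1 := (tendsto_expansion ha c).eventually_ge_atTop (q + 4)
      have h2 := (tendsto_expansion_div (√(q : ℝ) / 2) c).eventually_le_const
        (show (0 : ℝ) < 1 / 8 by norm_num)
      have h3 := (tendsto_expansion_pow_three_div (√(q : ℝ) / 2) c).eventually_le_const one_pos
      have h4 : ∀ᶠ t : ℝ in atTop, (q + 4 ≤ expansion (√(q : ℝ) / 2) c t) ∧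
          (expansion (√(q : ℝ) / 2) c t ≤ t / 8) ∧
          (expansion (√(q : ℝ) / 2) c t ^ 3 / t ^ 2 ≤ 1) := by
        filter_upwards [h1, h2, h3, eventually_gt_atTop 0] with t h1 h2 h3 ht
        refine ⟨h1, ?_, h3⟩
        rw [div_le_iff₀ ht] at h2
        linarith
      exact tendsto_natCast_atTop_atTop.eventually h4
    have hlow := (tendsto_natCast_atTop_atTop (R := ℝ)).eventually
      ((tendsto_mul_log_expansion_sub_atTop (c := √(q : ℝ) / 4 - ε / 2) ha hqa (by
        have := Real.mul_self_sqrt hq'.le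
        have := Real.sqrt_pos.mpr hq'
        nlinarith)).eventually_ge_atTop (9 + q * Real.log (4 * q)))
    have hup := (tendsto_natCast_atTop_atTop (R := ℝ)).eventually
      ((tendsto_mul_log_expansion_sub_atBot (c := √(q : ℝ) / 4 + ε / 2) ha hqa (by
        have := Real.mul_self_sqrt hq'.le
        have := Real.sqrt_pos.mpr hq'
        nlinarith)).eventually_lt_atBot (-(16 + Real.log (q + 1) + q * Real.log 8)))
    filter_upwards [hw1, hev (√(q : ℝ) / 4 - ε / 2), hev (√(q : ℝ) / 4 + ε / 2), hlow, hup,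
      eventually_ge_atTop (q + 2)] with n hn h1 h2 h3 h4 hnq
    obtain ⟨r, hrn, hr, hrpos⟩ := coeff_nonneg_of_log_bound hq (by linarith) h1.2.1 h1.2.2 h3
    have h5 : r ≤ f n := (hf n (by omega) r).mpr ⟨hrn, hrpos⟩
    obtain ⟨h6, h7⟩ := (hf n (by omega) (f n)).mp le_rfl
    have h8 := le_of_coeff_nonneg (by linarith) h2.2.1 h2.2.2 h4 h6 h7
    have h9 : (r : ℝ) ≤ f n := by exact_mod_cast h5
    have hn1 : (1 : ℝ) < n := by exact_mod_cast (show 1 < n by omega)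
    have hL : 0 < Real.log n := Real.log_pos hn1
    have hexp : ∀ c, expansion (√(q : ℝ) / 2) c n =
        (1 / 2 : ℝ) * Real.sqrt ((q : ℝ) * (n : ℝ) * Real.log (n : ℝ)) +
          c * (√((n : ℝ) / Real.log n) * Real.log (Real.log n)) := by
      intro c
      have h10 : √((q : ℝ) * n * Real.log n) = √q * (√((n : ℝ) / Real.log n) * Real.log n) := by
        rw [mul_assoc, Real.sqrt_mul hq'.le]
        congr 1
        rw [Real.sqrt_eq_iff_mul_self_eq (by positivity) (by positivity)]
        rw [mul_mul_mul_comm, Real.mul_self_sqrt (by positivity)]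
        field_simp
      rw [h10, expansion]
      ring
    have h11 : √((q : ℝ) * n / Real.log n) = √q * √((n : ℝ) / Real.log n) := by
      rw [mul_div_assoc, Real.sqrt_mul hq'.le]
    rw [hexp] at hr h8
    rw [div_le_iff₀ hε] at hn
    rw [Real.norm_eq_abs, Real.norm_of_nonneg (by nlinarith), abs_le, h11]
    constructor <;> nlinarith

end Threshold

end HilbertDepth

namespace HilbertDepth

/-! ### Graded pieces of the polynomial ring and division by the least variable -/

section Components

open MvPolynomial

variable {K : Type*} [Field K] {n : ℕ}

theorem component_natCast (m : ℕ) :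
    component K n (m : ℤ) = homogeneousSubmodule (Fin n) K m := rfl

theorem component_of_neg {d : ℤ} (hd : d < 0) : component K n d = ⊥ := by
  obtain ⟨m, rfl⟩ := Int.eq_negSucc_of_lt_zero hd
  rfl

noncomputable def componentEquiv (n m : ℕ) :
    homogeneousSubmodule (Fin n) K m ≃ₗ[K] ({a : Fin n →₀ ℕ | a.degree = m} →₀ K) :=
  (LinearEquiv.ofEq _ _ (homogeneousSubmodule_eq_finsupp_supported (Fin n) K m)).trans
    (AddMonoidAlgebra.supportedEquivFinsupp _)

theorem setOf_degree_eq (n m : ℕ) :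
    {a : Fin n →₀ ℕ | a.degree = m} = (Finset.univ : Finset (Fin n)).finsuppAntidiag m := by
  ext a
  simp [Finsupp.degree_eq_sum]

instance finite_degree_eq (n m : ℕ) : Finite {a : Fin n →₀ ℕ | a.degree = m} := by
  rw [setOf_degree_eq]
  infer_instance

instance finiteDimensional_homogeneousSubmodule (m : ℕ) :
    FiniteDimensional K (homogeneousSubmodule (Fin n) K m) :=
  Module.Finite.equiv (componentEquiv n m).symm

theorem finrank_homogeneousSubmodule (m : ℕ) :
    Module.finrank K (homogeneousSubmodule (Fin n) K m) = n.multichoose m := by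
  have := Fintype.ofFinite {a : Fin n →₀ ℕ | a.degree = m}
  rw [(componentEquiv n m).finrank_eq, Module.finrank_finsupp_self, ← Nat.card_eq_fintype_card,
    setOf_degree_eq, Nat.card_coe_set_eq, Set.ncard_coe_finset,
    Finset.card_finsuppAntidiag_nat_eq_multichoose, Finset.card_univ, Fintype.card_fin]

instance finiteDimensional_component (d : ℤ) : FiniteDimensional K (component K n d) := by
  cases d with
  | ofNat m => exact finiteDimensional_homogeneousSubmodule m
  | negSucc m => rw [component_of_neg (Int.negSucc_lt_zero m)]; infer_instance

theorem X_mul_mem_component {d : ℤ} (i : Fin n) {p : MvPolynomial (Fin n) K}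
    (hp : p ∈ component K n d) : X i * p ∈ component K n (d + 1) := by
  cases d with
  | ofNat m =>
    have h : (X i * p).IsHomogeneous (1 + m) := (isHomogeneous_X K i).mul hp
    rw [add_comm] at h
    exact h
  | negSucc m =>
    rw [component_of_neg (Int.negSucc_lt_zero m), Submodule.mem_bot] at hp
    rw [hp, mul_zero]
    exact zero_mem _

/-- On monomials: divide by `X i` if `i` is the smallest index of a variable that occurs, and
otherwise take the value `0`. -/
noncomputable def divMin (i : Fin n) : MvPolynomial (Fin n) K →ₗ[K] MvPolynomial (Fin n) K :=
  (basisMonomials (Fin n) K).constr K fun a =>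
    if a i ≠ 0 ∧ ∀ j < i, a j = 0 then monomial (a - Finsupp.single i 1) 1 else 0

/-- The part of a polynomial in the variables of index at least `i`. -/
noncomputable def highPart (i : Fin n) : MvPolynomial (Fin n) K →ₗ[K] MvPolynomial (Fin n) K :=
  (basisMonomials (Fin n) K).constr K fun a => if ∀ j < i, a j = 0 then monomial a 1 else 0

theorem divMin_monomial (i : Fin n) (a : Fin n →₀ ℕ) :
    divMin i (monomial a (1 : K)) =
      if a i ≠ 0 ∧ ∀ j < i, a j = 0 then monomial (a - Finsupp.single i 1) 1 else 0 :=
  (basisMonomials (Fin n) K).constr_basis K _ a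

theorem highPart_monomial (i : Fin n) (a : Fin n →₀ ℕ) :
    highPart i (monomial a (1 : K)) = if ∀ j < i, a j = 0 then monomial a 1 else 0 :=
  (basisMonomials (Fin n) K).constr_basis K _ a

theorem X_mul_monomial (i : Fin n) (a : Fin n →₀ ℕ) :
    X i * monomial a (1 : K) = monomial (a + Finsupp.single i 1) 1 := by
  rw [X, monomial_mul, one_mul, add_comm]

theorem X_mul_divMin_monomial (i : Fin n) (a : Fin n →₀ ℕ) :
    X i * divMin i (monomial a (1 : K)) =
      if a i ≠ 0 ∧ ∀ j < i, a j = 0 then monomial a 1 else 0 := by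
  rw [divMin_monomial]
  split_ifs with h
  · rw [X_mul_monomial, tsub_add_cancel_of_le]
    rw [Finsupp.single_le_iff]
    omega
  · exact mul_zero _

theorem divMin_X_mul_self (i : Fin n) (p : MvPolynomial (Fin n) K) :
    divMin i (X i * p) = highPart i p := by
  suffices h : divMin i ∘ₗ LinearMap.mulLeft K (X i) = highPart i from LinearMap.congr_fun h p
  refine (basisMonomials (Fin n) K).ext fun a => ?_
  simp only [coe_basisMonomials, LinearMap.comp_apply, LinearMap.mulLeft_apply, X_mul_monomial,
    divMin_monomial, highPart_monomial]
  have h : (∀ j < i, (a + Finsupp.single i 1 : Fin n →₀ ℕ) j = 0) ↔ ∀ j < i, a j = 0 :=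
    forall₂_congr fun j hj => by simp [Finsupp.single_eq_of_ne hj.ne]
  simp only [h]
  simp

theorem divMin_X_mul_of_lt {i j : Fin n} (h : j < i) (p : MvPolynomial (Fin n) K) :
    divMin i (X j * p) = 0 := by
  suffices h : divMin i ∘ₗ LinearMap.mulLeft K (X j) = 0 from LinearMap.congr_fun h p
  refine (basisMonomials (Fin n) K).ext fun a => ?_
  simp only [coe_basisMonomials, LinearMap.comp_apply, LinearMap.mulLeft_apply, X_mul_monomial,
    divMin_monomial, LinearMap.zero_apply]
  exact if_neg fun h2 => by simpa using h2.2 j h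

theorem divMin_X_mul_of_gt {i j : Fin n} (h : i < j) (p : MvPolynomial (Fin n) K) :
    divMin i (X j * p) = X j * divMin i p := by
  suffices h : divMin i ∘ₗ LinearMap.mulLeft K (X j) = LinearMap.mulLeft K (X j) ∘ₗ divMin i from
    LinearMap.congr_fun h p
  refine (basisMonomials (Fin n) K).ext fun a => ?_
  simp only [coe_basisMonomials, LinearMap.comp_apply, LinearMap.mulLeft_apply, X_mul_monomial,
    divMin_monomial]
  have h1 : (∀ l < i, (a + Finsupp.single j 1 : Fin n →₀ ℕ) l = 0) ↔ ∀ l < i, a l = 0 :=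
    forall₂_congr fun l hl => by simp [Finsupp.single_eq_of_ne (hl.trans h).ne]
  have h2 : (a + Finsupp.single j 1 : Fin n →₀ ℕ) i = a i := by simp [Finsupp.single_eq_of_ne h.ne]
  simp only [h1, h2]
  split_ifs with h3
  · have h4 : a + Finsupp.single j 1 - Finsupp.single i 1 =
        a - Finsupp.single i 1 + Finsupp.single j 1 := by
      ext l
      simp only [Finsupp.tsub_apply, Finsupp.add_apply]
      rcases eq_or_ne l i with rfl | hl
      · simp [Finsupp.single_eq_of_ne h.ne]
      · simp [Finsupp.single_eq_of_ne hl]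
    rw [X_mul_monomial, h4]
  · exact (mul_zero _).symm

/-- A monomial has at most one least variable, and downward closure puts its index in S as soon as
some variable from S occurs. -/
theorem sum_ite_isLeast {a : Fin n →₀ ℕ} {S : Finset (Fin n)}
    (hS : ∀ i ∈ S, ∀ j < i, j ∈ S) (v : MvPolynomial (Fin n) K) :
    ∑ i ∈ S, (if a i ≠ 0 ∧ ∀ j < i, a j = 0 then v else 0) =
      if ∀ i ∈ S, a i = 0 then 0 else v := by
  split_ifs with h
  · exact Finset.sum_eq_zero fun i hi => if_neg fun h2 => h2.1 (h i hi)
  · push Not at h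
    obtain ⟨i, ⟨hi, hai⟩, hmin⟩ := exists_minimal_of_wellFoundedLT (fun i => i ∈ S ∧ a i ≠ 0) h
    have hlt : ∀ j < i, a j = 0 := fun j hj => by
      by_contra h2
      exact absurd (hmin ⟨hS i hi j hj, h2⟩ hj.le) (not_le.mpr hj)
    rw [Finset.sum_eq_single_of_mem i hi, if_pos ⟨hai, hlt⟩]
    intro j _ hji
    refine if_neg fun h2 => ?_
    rcases lt_or_gt_of_ne hji with h3 | h3
    · exact h2.1 (hlt j h3)
    · exact hai (h2.2 i h3)

theorem sum_X_mul_divMin_add_highPart (i : Fin n) (p : MvPolynomial (Fin n) K) :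
    ∑ j ∈ Finset.univ.filter (· < i), X j * divMin j p + highPart i p = p := by
  suffices h : ∑ j ∈ Finset.univ.filter (· < i), LinearMap.mulLeft K (X j) ∘ₗ divMin j +
      highPart i = LinearMap.id by
    simpa using LinearMap.congr_fun h p
  refine (basisMonomials (Fin n) K).ext fun a => ?_
  simp only [coe_basisMonomials, LinearMap.add_apply, LinearMap.sum_apply, LinearMap.comp_apply,
    LinearMap.mulLeft_apply, X_mul_divMin_monomial, highPart_monomial, LinearMap.id_apply]
  rw [sum_ite_isLeast (fun j hj l hl => by
    simp only [Finset.mem_filter, Finset.mem_univ, true_and] at hj ⊢; exact hl.trans hj)]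
  simp only [Finset.mem_filter, Finset.mem_univ, true_and]
  split_ifs <;> simp

theorem sum_X_mul_divMin (p : MvPolynomial (Fin n) K) :
    ∑ j, X j * divMin j p + C (coeff 0 p) = p := by
  suffices h : ∑ j, LinearMap.mulLeft K (X j) ∘ₗ divMin j +
      (Algebra.linearMap K (MvPolynomial (Fin n) K)) ∘ₗ lcoeff K 0 = LinearMap.id by
    simpa [algebraMap_eq] using LinearMap.congr_fun h p
  refine (basisMonomials (Fin n) K).ext fun a => ?_
  simp only [coe_basisMonomials, LinearMap.add_apply, LinearMap.sum_apply, LinearMap.comp_apply,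
    LinearMap.mulLeft_apply, X_mul_divMin_monomial, LinearMap.id_apply]
  rw [sum_ite_isLeast (fun _ _ _ _ => Finset.mem_univ _)]
  simp only [Finset.mem_univ, true_implies]
  by_cases h : a = 0
  · subst h
    simp
  · have h2 : ¬ ∀ i, a i = 0 := fun h2 => h (Finsupp.ext h2)
    simp [h2, coeff_monomial, h]

theorem divMin_mem_component {d : ℤ} (i : Fin n) {p : MvPolynomial (Fin n) K}
    (hp : p ∈ component K n d) : divMin i p ∈ component K n (d - 1) := by
  cases d with
  | negSucc m =>
    rw [component_of_neg (Int.negSucc_lt_zero m), Submodule.mem_bot] at hp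
    rw [hp, map_zero]
    exact zero_mem _
  | ofNat m =>
    have hp' : p.IsHomogeneous m := hp
    rw [p.as_sum, map_sum]
    refine sum_mem fun a ha => ?_
    have hdeg : a.degree = m := by
      rw [Finsupp.degree_eq_weight_one]; exact hp' (mem_support_iff.mp ha)
    rw [show monomial a (coeff a p) = coeff a p • monomial a (1 : K) by simp [smul_monomial], map_smul, divMin_monomial]
    refine Submodule.smul_mem _ _ ?_
    split_ifs with h
    · have h1 : a - Finsupp.single i 1 + Finsupp.single i 1 = a := by
        rw [tsub_add_cancel_of_le]
        rw [Finsupp.single_le_iff]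
        omega
      have h2 := congrArg Finsupp.degree h1
      rw [map_add, Finsupp.degree_single, hdeg] at h2
      obtain rfl : (a - Finsupp.single i 1).degree + 1 = m := h2
      have h3 : Int.ofNat ((a - Finsupp.single i 1).degree + 1) - 1 =
          ((a - Finsupp.single i 1).degree : ℤ) := by simp
      rw [h3, component_natCast]
      exact isHomogeneous_monomial _ rfl
    · exact zero_mem _

end Components

end HilbertDepth

namespace HilbertDepth

/-! ### Exactness of the Koszul complex by a contracting homotopy -/

section KoszulExactness

open MvPolynomial

variable {K : Type*} [Field K] {n : ℕ}

/-- The sign `(-1)^r` where `r` is the number of elements of `T` below `i`. -/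
noncomputable def koszulSign (K : Type*) [Field K] {n : ℕ} (T : Finset (Fin n)) (i : Fin n) :
    MvPolynomial (Fin n) K :=
  (-1) ^ (T.filter (fun t => t < i)).card

/-- The Koszul differential on coefficient functions defined on all finite subsets. -/
noncomputable def totalD (f : Finset (Fin n) → MvPolynomial (Fin n) K) (T : Finset (Fin n)) :
    MvPolynomial (Fin n) K :=
  ∑ i ∈ Tᶜ, koszulSign K T i * X i * f (insert i T)

/-- A contracting homotopy for `totalD`. -/
noncomputable def totalS (f : Finset (Fin n) → MvPolynomial (Fin n) K) (T : Finset (Fin n)) :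
    MvPolynomial (Fin n) K :=
  if h : T.Nonempty then divMin (T.min' h) (f (T.erase (T.min' h))) else 0

theorem koszulSign_insert_of_lt {T : Finset (Fin n)} {i j : Fin n} (hi : i ∉ T) (hij : i < j) :
    koszulSign K (insert i T) j = -koszulSign K T j := by
  rw [koszulSign, koszulSign, Finset.filter_insert, if_pos hij,
    Finset.card_insert_of_notMem (fun h => hi (Finset.mem_filter.mp h).1), pow_succ]
  ring

theorem koszulSign_insert_of_le {T : Finset (Fin n)} {i j : Fin n} (hij : j ≤ i) :
    koszulSign K (insert i T) j = koszulSign K T j := by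
  rw [koszulSign, koszulSign, Finset.filter_insert, if_neg (not_lt.mpr hij)]

theorem koszulSign_of_le {T : Finset (Fin n)} {i : Fin n} (h : ∀ t ∈ T, i ≤ t) :
    koszulSign K T i = 1 := by
  rw [koszulSign, Finset.filter_false_of_mem fun t ht => not_lt.mpr (h t ht)]
  simp

theorem totalD_totalD (f : Finset (Fin n) → MvPolynomial (Fin n) K) (T : Finset (Fin n)) :
    totalD (totalD f) T = 0 := by
  simp only [totalD, Finset.mul_sum]
  rw [Finset.sum_sigma']
  refine Finset.sum_involution (fun p _ => ⟨p.2, p.1⟩) ?_ ?_ ?_ (fun _ _ => rfl)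
  · rintro ⟨i, j⟩ h
    simp only [Finset.mem_sigma, Finset.mem_compl, Finset.mem_insert, not_or] at h
    obtain ⟨hi, hji, hj⟩ := h
    simp only
    rw [Finset.insert_comm j i]
    rcases lt_or_gt_of_ne hji with h1 | h1
    · rw [koszulSign_insert_of_le h1.le, koszulSign_insert_of_lt hj h1]
      ring
    · rw [koszulSign_insert_of_lt hi h1, koszulSign_insert_of_le h1.le]
      ring
  · rintro ⟨i, j⟩ h _
    simp only [Finset.mem_sigma, Finset.mem_compl, Finset.mem_insert, not_or] at h
    intro h2
    exact h.2.1 (congrArg Sigma.fst h2)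
  · rintro ⟨i, j⟩ h
    simp only [Finset.mem_sigma, Finset.mem_compl, Finset.mem_insert, not_or] at h ⊢
    exact ⟨h.2.2, fun h2 => h.2.1 h2.symm, h.1⟩

theorem totalS_insert_of_forall_lt (f : Finset (Fin n) → MvPolynomial (Fin n) K)
    {T : Finset (Fin n)} {i : Fin n} (h : ∀ t ∈ T, i < t) :
    totalS f (insert i T) = divMin i (f T) := by
  have hne : (insert i T).Nonempty := Finset.insert_nonempty i T
  have hmin : (insert i T).min' hne = i := by
    refine le_antisymm (Finset.min'_le _ _ (Finset.mem_insert_self i T)) ?_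
    refine Finset.le_min' _ _ _ fun t ht => ?_
    rcases Finset.mem_insert.mp ht with rfl | ht
    · exact le_rfl
    · exact (h t ht).le
  rw [totalS, dif_pos hne, hmin, Finset.erase_insert fun hi => lt_irrefl i (h i hi)]

theorem divMin_koszulSign_mul (i : Fin n) (T : Finset (Fin n)) (j : Fin n)
    (p : MvPolynomial (Fin n) K) :
    divMin i (koszulSign K T j * p) = koszulSign K T j * divMin i p := by
  rcases neg_one_pow_eq_or (MvPolynomial (Fin n) K) (T.filter (fun t => t < j)).card with h | h <;>
    simp [koszulSign, h]

/-- Indices j > i contribute to both composites with opposite signs, since i precedes j. Indices j <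
i give the terms X_j * `divMin j`, and i itself gives `highPart i`; together these sort the
monomials of the coefficient by their least variable. -/
theorem totalD_totalS_add_insert (f : Finset (Fin n) → MvPolynomial (Fin n) K)
    {T : Finset (Fin n)} {i : Fin n} (h : ∀ t ∈ T, i < t) :
    totalD (totalS f) (insert i T) + totalS (totalD f) (insert i T) = f (insert i T) := by
  have hi : i ∉ T := fun hi => lt_irrefl i (h i hi)
  have hcompl : Tᶜ = insert i (insert i T)ᶜ := by
    ext j
    by_cases hj : j = i <;> simp [hj, hi]
  rw [totalS_insert_of_forall_lt _ h, totalD, totalD, hcompl, Finset.sum_insert (by simp),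
    map_add, koszulSign_of_le fun t ht => (h t ht).le, one_mul, divMin_X_mul_self, map_sum,
    add_left_comm, ← Finset.sum_add_distrib]
  conv_rhs => rw [← sum_X_mul_divMin_add_highPart i (f (insert i T))]
  rw [add_comm]
  congr 1
  rw [← Finset.sum_subset (s₁ := Finset.univ.filter (· < i)) (s₂ := (insert i T)ᶜ)]
  · refine Finset.sum_congr rfl fun j hj => ?_
    have hj : j < i := by simpa using hj
    have hlt : ∀ t ∈ insert i T, j < t := fun t ht => by
      rcases Finset.mem_insert.mp ht with rfl | ht
      · exact hj
      · exact hj.trans (h t ht)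
    rw [totalS_insert_of_forall_lt f hlt, koszulSign_of_le fun t ht => (hlt t ht).le, one_mul,
      mul_assoc, divMin_koszulSign_mul, divMin_X_mul_of_lt hj, mul_zero, add_zero]
  · intro j hj
    have hj : j < i := by simpa using hj
    simp only [Finset.mem_compl, Finset.mem_insert, not_or]
    exact ⟨hj.ne, fun hjT => lt_asymm hj (h j hjT)⟩
  · intro j hj hj2
    simp only [Finset.mem_compl, Finset.mem_insert, not_or] at hj
    have hij : i < j := lt_of_le_of_ne (by simpa using hj2) (Ne.symm hj.1)
    rw [Finset.insert_comm, totalS_insert_of_forall_lt f (fun t ht => by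
        rcases Finset.mem_insert.mp ht with rfl | ht
        · exact hij
        · exact h t ht),
      koszulSign_insert_of_lt hi hij, mul_assoc, mul_assoc, divMin_koszulSign_mul,
      divMin_X_mul_of_gt hij]
    ring

theorem totalD_totalS_add {T : Finset (Fin n)} (hT : T.Nonempty)
    (f : Finset (Fin n) → MvPolynomial (Fin n) K) :
    totalD (totalS f) T + totalS (totalD f) T = f T := by
  have h := totalD_totalS_add_insert f (T := T.erase (T.min' hT)) (i := T.min' hT)
    (fun t ht => T.min'_lt_of_mem_erase_min' hT ht)
  rwa [Finset.insert_erase (T.min'_mem hT)] at h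

/-- At the end of the complex the constant term is the only obstruction: the homology there is K. -/
theorem totalD_totalS_empty (f : Finset (Fin n) → MvPolynomial (Fin n) K) (h : coeff 0 (f ∅) = 0) :
    totalD (totalS f) ∅ = f ∅ := by
  conv_rhs => rw [← sum_X_mul_divMin (f ∅), h, map_zero, add_zero]
  rw [totalD, Finset.compl_empty]
  refine Finset.sum_congr rfl fun i _ => ?_
  rw [totalS_insert_of_forall_lt f (by simp), koszulSign_of_le (by simp), one_mul]

/-- Extension by zero of an element of `⋀ʲ Rⁿ` to a function on all finite subsets. -/
noncomputable def extendZero {j : ℕ} (f : Koszul K n j) (T : Finset (Fin n)) :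
    MvPolynomial (Fin n) K :=
  if h : T.card = j then f ⟨T, h⟩ else 0

theorem extendZero_coe {j : ℕ} (f : Koszul K n j) (T : {T : Finset (Fin n) // T.card = j}) :
    extendZero f T.1 = f T := dif_pos T.2

theorem extendZero_koszulD {j : ℕ} (f : Koszul K n (j + 1)) :
    extendZero (koszulD K n j f) = totalD (extendZero f) := by
  funext T
  rw [totalD]
  by_cases h : T.card = j
  · rw [extendZero, dif_pos h]
    change ∑ i : {i : Fin n // i ∉ T}, _ = _
    rw [Finset.sum_subtype (p := fun i => i ∉ T) Tᶜ (by simp)]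
    refine Finset.sum_congr rfl fun i _ => ?_
    rw [koszulSign, extendZero, dif_pos (by rw [Finset.card_insert_of_notMem i.2, h])]
  · rw [extendZero, dif_neg h, Finset.sum_eq_zero]
    intro i hi
    rw [extendZero, dif_neg, mul_zero]
    rw [Finset.card_insert_of_notMem (Finset.mem_compl.mp hi)]
    omega

/-- The contracting homotopy `⋀ʲ Rⁿ → ⋀ʲ⁺¹ Rⁿ`. -/
noncomputable def koszulS {j : ℕ} (f : Koszul K n j) : Koszul K n (j + 1) :=
  fun T => totalS (extendZero f) T.1

theorem extendZero_koszulS {j : ℕ} (f : Koszul K n j) :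
    extendZero (koszulS f) = totalS (extendZero f) := by
  funext T
  rw [extendZero]
  split_ifs with h
  · rfl
  · rw [totalS]
    split_ifs with hT
    · have h2 := Finset.card_erase_add_one (T.min'_mem hT)
      rw [extendZero, dif_neg (by omega), map_zero]
    · rfl

theorem extendZero_injective {j : ℕ} :
    Function.Injective (extendZero : Koszul K n j → Finset (Fin n) → _) := fun f g h => by
  funext T
  rw [← extendZero_coe f T, h, extendZero_coe]

theorem koszulD_koszulD {j : ℕ} (f : Koszul K n (j + 1 + 1)) :
    koszulD K n j (koszulD K n (j + 1) f) = 0 := by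
  apply extendZero_injective
  funext T
  rw [extendZero_koszulD, extendZero_koszulD, totalD_totalD]
  simp [extendZero]

theorem koszulD_koszulS_of_koszulD_eq_zero {j : ℕ} {f : Koszul K n (j + 1)}
    (h : koszulD K n j f = 0) : koszulD K n (j + 1) (koszulS f) = f := by
  funext T
  have hT : T.1.Nonempty := Finset.card_pos.mp (by rw [T.2]; omega)
  have h1 := totalD_totalS_add hT (extendZero f)
  have h2 : extendZero (koszulD K n j f) = 0 := by
    rw [h]; funext T; simp [extendZero]
  rw [← extendZero_koszulD, h2, ← extendZero_koszulS, ← extendZero_koszulD, extendZero_coe,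
    extendZero_coe] at h1
  rw [← h1]
  simp [totalS, hT]

theorem koszulD_koszulS_zero {f : Koszul K n 0} (h : coeff 0 (f ⟨∅, Finset.card_empty⟩) = 0) :
    koszulD K n 0 (koszulS f) = f := by
  funext ⟨T, hT⟩
  obtain rfl := Finset.card_eq_zero.mp hT
  rw [← extendZero_coe (koszulD K n 0 (koszulS f)), ← extendZero_coe f, extendZero_koszulD, extendZero_koszulS]
  exact totalD_totalS_empty _ h

theorem coeff_zero_koszulD (f : Koszul K n 1) : coeff 0 (koszulD K n 0 f ⟨∅, Finset.card_empty⟩) = 0 := by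
  rw [← extendZero_coe (koszulD K n 0 f), extendZero_koszulD, totalD, coeff_sum]
  refine Finset.sum_eq_zero fun i _ => ?_
  rw [mul_right_comm, mul_comm, coeff_X_mul']
  simp

/-! ### The Hilbert function of the syzygy modules -/

theorem mem_koszulComponent {j : ℕ} {d : ℤ} {f : Koszul K n j} :
    f ∈ Koszul.component K n j d ↔ ∀ T, f T ∈ component K n (d - j) := by
  simp [Koszul.component, Submodule.mem_pi]

theorem koszulD_mem_component {j : ℕ} {d : ℤ} {f : Koszul K n (j + 1)}
    (hf : f ∈ Koszul.component K n (j + 1) d) :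
    koszulD K n j f ∈ Koszul.component K n j d := by
  rw [mem_koszulComponent] at hf ⊢
  intro T
  rw [← extendZero_coe (koszulD K n j f) T, extendZero_koszulD, totalD]
  refine Submodule.sum_mem _ fun i hi => ?_
  have hcard : (insert i T.1).card = j + 1 := by
    rw [Finset.card_insert_of_notMem (Finset.mem_compl.mp hi), T.2]
  have h := X_mul_mem_component i (hf ⟨insert i T.1, hcard⟩)
  rw [show d - ((j + 1 : ℕ) : ℤ) + 1 = d - j by push_cast; ring] at h
  rw [extendZero, dif_pos hcard, koszulSign, mul_assoc]
  rcases neg_one_pow_eq_or (MvPolynomial (Fin n) K)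
    (T.1.filter (fun t => t < i)).card with h1 | h1
  · rw [h1, one_mul]; exact h
  · rw [h1, neg_one_mul]; exact neg_mem h

theorem koszulS_mem_component {j : ℕ} {d : ℤ} {f : Koszul K n j}
    (hf : f ∈ Koszul.component K n j d) : koszulS f ∈ Koszul.component K n (j + 1) d := by
  rw [mem_koszulComponent] at hf ⊢
  intro T
  rw [koszulS, totalS]
  split_ifs with h
  · rw [show d - ((j + 1 : ℕ) : ℤ) = d - j - 1 by push_cast; ring]
    refine divMin_mem_component _ ?_
    rw [extendZero]
    split_ifs
    · exact hf _
    · exact zero_mem _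
  · exact zero_mem _

/-- The homogeneous component of degree `d` of `M(n, q + 1)`, as a subspace of `⋀^q Rⁿ`. -/
noncomputable def syzygyPart (K : Type*) [Field K] (n q : ℕ) (d : ℤ) :
    Submodule K (Koszul K n q) :=
  syzygyComponent K n (q + 1) d

theorem mem_syzygyPart {q : ℕ} {d : ℤ} {f : Koszul K n q} :
    f ∈ syzygyPart K n q d ↔
      (∃ g, koszulD K n q g = f) ∧ f ∈ Koszul.component K n q d := Iff.rfl

theorem koszulD_koszulS_of_mem_range {q : ℕ} {f : Koszul K n q}
    (hf : ∃ g, koszulD K n q g = f) : koszulD K n q (koszulS f) = f := by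
  obtain ⟨g, rfl⟩ := hf
  cases q with
  | zero => exact koszulD_koszulS_zero (coeff_zero_koszulD g)
  | succ q => exact koszulD_koszulS_of_koszulD_eq_zero (koszulD_koszulD g)

/-- The Koszul differential in degree `d`. -/
noncomputable def koszulDComponent (K : Type*) [Field K] (n q : ℕ) (d : ℤ) :
    Koszul.component K n (q + 1) d →ₗ[K] Koszul K n q :=
  ((koszulD K n q).restrictScalars K).domRestrict (Koszul.component K n (q + 1) d)

theorem range_koszulDComponent (q : ℕ) (d : ℤ) :
    LinearMap.range (koszulDComponent K n q d) = syzygyPart K n q d := by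
  ext f
  constructor
  · rintro ⟨g, rfl⟩
    exact ⟨⟨g.1, rfl⟩, koszulD_mem_component g.2⟩
  · intro hf
    rw [mem_syzygyPart] at hf
    exact ⟨⟨koszulS f, koszulS_mem_component hf.2⟩, koszulD_koszulS_of_mem_range hf.1⟩

theorem ker_koszulDComponent (q : ℕ) (d : ℤ) :
    LinearMap.ker (koszulDComponent K n q d) =
      (syzygyPart K n (q + 1) d).comap (Koszul.component K n (q + 1) d).subtype := by
  ext f
  rw [LinearMap.mem_ker, Submodule.mem_comap]
  constructor
  · intro h
    exact ⟨⟨koszulS f.1, koszulD_koszulS_of_koszulD_eq_zero h⟩, f.2⟩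
  · rintro ⟨⟨g, hg⟩, -⟩
    change koszulD K n q f.1 = 0
    have hg : koszulD K n (q + 1) g = f.1 := hg
    rw [← hg]
    exact koszulD_koszulD g

noncomputable def koszulComponentEquiv (j : ℕ) (d : ℤ) : Koszul.component K n j d ≃ₗ[K]
    ({T : Finset (Fin n) // T.card = j} → component K n (d - j)) where
  toFun f T := ⟨f.1 T, mem_koszulComponent.mp f.2 T⟩
  invFun f := ⟨fun T => (f T).1, mem_koszulComponent.mpr fun T => (f T).2⟩
  map_add' _ _ := rfl
  map_smul' _ _ := rfl
  left_inv _ := rfl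
  right_inv _ := rfl

instance finiteDimensional_koszulComponent (j : ℕ) (d : ℤ) :
    FiniteDimensional K (Koszul.component K n j d) :=
  Module.Finite.equiv (koszulComponentEquiv j d).symm

theorem finrank_koszulComponent (j : ℕ) (d : ℤ) :
    Module.finrank K (Koszul.component K n j d) =
      n.choose j * Module.finrank K (component K n (d - j)) := by
  rw [(koszulComponentEquiv j d).finrank_eq, Module.finrank_pi_fintype]
  simp

theorem syzygyPart_le (q : ℕ) (d : ℤ) :
    syzygyPart K n q d ≤ Koszul.component K n q d := inf_le_right

instance finiteDimensional_syzygyPart (q : ℕ) (d : ℤ) :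
    FiniteDimensional K (syzygyPart K n q d) :=
  Submodule.finiteDimensional_of_le (syzygyPart_le q d)

/-- Rank-nullity for the Koszul differential in degree d, whose kernel is the next syzygy module by
exactness. The recursion `numerator_succ` mirrors this identity. -/
theorem finrank_syzygyPart_add (q : ℕ) (d : ℤ) :
    Module.finrank K (syzygyPart K n q d) +
      Module.finrank K (syzygyPart K n (q + 1) d) =
        n.choose (q + 1) * Module.finrank K (component K n (d - (q + 1 : ℕ))) := by
  rw [← finrank_koszulComponent, ← (koszulDComponent K n q d).finrank_range_add_finrank_ker,
    range_koszulDComponent, ker_koszulDComponent,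
    (Submodule.comapSubtypeEquivOfLe (syzygyPart_le (q + 1) d)).finrank_eq]

theorem syzygyPart_zero {d : ℤ} (hd : d ≠ 0) :
    syzygyPart K n 0 d = Koszul.component K n 0 d := by
  refine le_antisymm (syzygyPart_le 0 d) fun f hf => ⟨?_, hf⟩
  refine ⟨koszulS f, koszulD_koszulS_zero ?_⟩
  have h := mem_koszulComponent.mp hf ⟨∅, Finset.card_empty⟩
  rw [Nat.cast_zero, sub_zero] at h
  cases d with
  | ofNat m =>
    have h' : (f ⟨∅, Finset.card_empty⟩).IsHomogeneous m := h
    by_contra h0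
    have h1 := h' h0
    simp only [map_zero] at h1
    exact hd (by simp [← h1])
  | negSucc m =>
    rw [component_of_neg (Int.negSucc_lt_zero m), Submodule.mem_bot] at h
    simp [h]

theorem syzygyPart_zero_zero : syzygyPart K n 0 0 = ⊥ := by
  rw [eq_bot_iff]
  rintro f ⟨⟨g, hg⟩, hf⟩
  rw [Submodule.mem_bot]
  funext ⟨T, hT⟩
  obtain rfl := Finset.card_eq_zero.mp hT
  have h0 : coeff 0 (f ⟨∅, Finset.card_empty⟩) = 0 := by
    rw [← hg]; exact coeff_zero_koszulD g
  have h : (f ⟨∅, Finset.card_empty⟩).IsHomogeneous 0 := by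
    have := mem_koszulComponent.mp hf ⟨∅, Finset.card_empty⟩
    rwa [Nat.cast_zero, sub_zero] at this
  ext a
  by_cases ha : a = 0
  · subst ha; simpa using h0
  · have : coeff a (f ⟨∅, Finset.card_empty⟩) = 0 := h.coeff_eq_zero (by
      rwa [ne_eq, Finsupp.degree_eq_zero_iff])
    simpa using this

theorem syzygyPart_of_neg (q : ℕ) {d : ℤ} (hd : d < 0) :
    syzygyPart K n q d = ⊥ := by
  rw [eq_bot_iff]
  rintro f ⟨-, hf⟩
  rw [Submodule.mem_bot]
  funext T
  have h := mem_koszulComponent.mp hf T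
  rwa [component_of_neg (by omega), Submodule.mem_bot] at h

theorem finrank_component_sub (d j : ℕ) :
    (Module.finrank K (component K n ((d : ℤ) - j)) : ℤ) =
      if j ≤ d then (n.multichoose (d - j) : ℤ) else 0 := by
  split_ifs with h
  · rw [← Nat.cast_sub h, component_natCast, finrank_homogeneousSubmodule]
  · rw [component_of_neg (by omega), finrank_bot, Nat.cast_zero]

theorem finrank_syzygyPart (q d : ℕ) :
    (Module.finrank K (syzygyPart K n q d) : ℤ) =
      PowerSeries.coeff d ((PowerSeries.mk 1) ^ n * numerator n q) := by
  induction q with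
  | zero =>
    rw [numerator_zero, mul_sub, mk_one_pow_mul_one_sub_pow, mul_one, map_sub, coeff_mk_one_pow]
    rcases Nat.eq_zero_or_pos d with rfl | hd
    · rw [Nat.cast_zero, syzygyPart_zero_zero]
      simp
    · rw [syzygyPart_zero (by exact_mod_cast hd.ne'), finrank_koszulComponent,
        Nat.cast_mul, finrank_component_sub]
      simp [PowerSeries.coeff_one, hd.ne']
  | succ q ih =>
    have h := finrank_syzygyPart_add (K := K) (n := n) q d
    have h2 := finrank_component_sub (K := K) (n := n) d (q + 1)
    rw [numerator_succ, mul_sub, map_sub, ← ih, ← map_natCast (PowerSeries.C (R := ℤ)),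
      mul_left_comm, PowerSeries.coeff_C_mul, PowerSeries.coeff_mul_X_pow', coeff_mk_one_pow,
      ← h2]
    zify at h
    push_cast at h ⊢
    linarith

end KoszulExactness

end HilbertDepth

namespace HilbertDepth

/-! ### Regular sequences on products and on polynomial rings -/

section WeaklyRegular

open RingTheory.Sequence

variable {R : Type*} [CommRing R]

theorem isWeaklyRegular_iff_smul_mem {M : Type*} [AddCommGroup M] [Module R M] (rs : List R) :
    IsWeaklyRegular M rs ↔ ∀ (i : ℕ) (h : i < rs.length) (x : M),
      rs[i] • x ∈ (Ideal.ofList (rs.take i) • ⊤ : Submodule R M) →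
        x ∈ (Ideal.ofList (rs.take i) • ⊤ : Submodule R M) := by
  rw [isWeaklyRegular_iff]
  exact forall₂_congr fun i h => isSMulRegular_quotient_iff_mem_of_smul_mem _ _

theorem mem_smul_top_pi_iff {ι : Type*} [Finite ι] {M : ι → Type*} [∀ i, AddCommGroup (M i)]
    [∀ i, Module R (M i)] (I : Ideal R) (x : (i : ι) → M i) :
    x ∈ (I • ⊤ : Submodule R ((i : ι) → M i)) ↔ ∀ i, x i ∈ (I • ⊤ : Submodule R (M i)) := by
  classical
  have := Fintype.ofFinite ι
  constructor
  · intro hx i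
    have h := Submodule.mem_map_of_mem (f := LinearMap.proj (R := R) (φ := M) i) hx
    rw [Submodule.map_smul''] at h
    exact Submodule.smul_mono le_rfl le_top h
  · intro hx
    rw [← Finset.univ_sum_single x]
    refine sum_mem fun i _ => ?_
    have h := Submodule.mem_map_of_mem (f := LinearMap.single R M i) (hx i)
    rw [Submodule.map_smul''] at h
    exact Submodule.smul_mono le_rfl le_top h

theorem isWeaklyRegular_pi_iff {ι : Type*} [Finite ι] {M : ι → Type*} [∀ i, AddCommGroup (M i)]
    [∀ i, Module R (M i)] (rs : List R) :
    IsWeaklyRegular ((i : ι) → M i) rs ↔ ∀ i, IsWeaklyRegular (M i) rs := by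
  classical
  simp only [isWeaklyRegular_iff_smul_mem, mem_smul_top_pi_iff]
  constructor
  · intro h j i hi x hx
    have h2 := h i hi (Pi.single j x) (fun l => by
      rcases eq_or_ne l j with rfl | hl
      · simpa using hx
      · simp [hl]) j
    simpa using h2
  · intro h i hi x hx j
    exact h j i hi (x j) (hx j)

/-- After localization at the origin, each element of a regular sequence lowers the Krull dimension
by one, starting from at most δ. -/
theorem length_le_of_isWeaklyRegular_mvPolynomial {K : Type*} [Field K] {δ : ℕ}
    {rs : List (MvPolynomial (Fin δ) K)} (hrs : IsWeaklyRegular (MvPolynomial (Fin δ) K) rs)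
    (hmem : ∀ r ∈ rs, MvPolynomial.constantCoeff r = 0) : rs.length ≤ δ := by
  let p : Ideal (MvPolynomial (Fin δ) K) := RingHom.ker (MvPolynomial.constantCoeff)
  have hp : p.IsPrime := RingHom.ker_isPrime _
  have hreg := hrs.isRegular_of_isLocalization_of_mem (Localization.AtPrime p) p
    (fun r hr => hmem r hr)
  have h1 := ringKrullDim_add_length_eq_ringKrullDim_of_isRegular _ hreg
  have h2 : ringKrullDim (Localization.AtPrime p) ≤ δ := by
    rw [IsLocalization.AtPrime.ringKrullDim_eq_height p]
    refine (Ideal.height_le_ringKrullDim_of_ne_top hp.ne_top).trans ?_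
    rw [MvPolynomial.ringKrullDim_of_isNoetherianRing]
    simp
  have h3 : Nontrivial (Localization.AtPrime p ⧸
      Ideal.ofList (rs.map (algebraMap _ (Localization.AtPrime p)))) := by
    refine Ideal.Quotient.nontrivial_iff.mpr fun h => hreg.top_ne_smul ?_
    rw [h]
    simp
  have h4 : (0 : WithBot ℕ∞) ≤ ringKrullDim (Localization.AtPrime p ⧸
      Ideal.ofList (rs.map (algebraMap _ (Localization.AtPrime p)))) :=
    ringKrullDim_nonneg_of_nontrivial
  rw [← h1, List.length_map] at h2
  have h5 : (rs.length : WithBot ℕ∞) ≤ δ := le_trans (le_add_of_nonneg_left h4) h2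
  exact_mod_cast h5

end WeaklyRegular

/-! ### Graded retracts as polynomial rings, and their depth -/

namespace GradedRetract

open MvPolynomial

variable {K : Type*} [Field K] {n : ℕ} (S : GradedRetract K n)

theorem mem_component_natCast {d : ℕ} {p : MvPolynomial (Fin n) K} :
    p ∈ S.component d ↔ S.proj p = p ∧ p.IsHomogeneous d := by
  constructor
  · rintro ⟨⟨r, rfl⟩, hp⟩
    exact ⟨S.proj_proj r, hp⟩
  · rintro ⟨h1, h2⟩
    exact ⟨⟨p, h1⟩, h2⟩

theorem component_of_neg {d : ℤ} (hd : d < 0) : S.component d = ⊥ := by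
  rw [component, HilbertDepth.component_of_neg hd, inf_bot_eq]

instance finiteDimensional_component (d : ℤ) : FiniteDimensional K (S.component d) :=
  Submodule.finiteDimensional_of_le
    (inf_le_right : S.component d ≤ HilbertDepth.component K n d)

/-- The number of variables of the polynomial ring to which `S` is isomorphic. -/
noncomputable def dim : ℕ := Module.finrank K (S.component 1)

noncomputable def linearBasis : Module.Basis (Fin S.dim) K (S.component 1) :=
  Module.finBasis K (S.component 1)

theorem linearBasis_mem (i : Fin S.dim) :
    S.proj (S.linearBasis i) = S.linearBasis i ∧
      (S.linearBasis i : MvPolynomial (Fin n) K).IsHomogeneous 1 :=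
  S.mem_component_natCast.mp (S.linearBasis i).2

/-- The parametrization of `S` by a polynomial ring. -/
noncomputable def embed : MvPolynomial (Fin S.dim) K →ₐ[K] MvPolynomial (Fin n) K :=
  aeval fun i => (S.linearBasis i : MvPolynomial (Fin n) K)

/-- The projection to the linear forms in `S`. -/
noncomputable def linearProj : MvPolynomial (Fin n) K →ₗ[K] S.component 1 :=
  (S.proj.toLinearMap ∘ₗ homogeneousComponent 1).codRestrict _ fun p =>
    S.mem_component_natCast.mpr ⟨S.proj_proj _,
      S.isHomogeneous_proj 1 _ (homogeneousComponent_isHomogeneous 1 p)⟩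

theorem coe_linearProj {p : MvPolynomial (Fin n) K} (hp : p.IsHomogeneous 1) :
    (S.linearProj p : MvPolynomial (Fin n) K) = S.proj p := by
  change S.proj (homogeneousComponent 1 p) = S.proj p
  rw [homogeneousComponent_eq_self hp]

theorem linearProj_linearBasis (i : Fin S.dim) :
    S.linearProj (S.linearBasis i) = S.linearBasis i :=
  Subtype.ext ((S.coe_linearProj (S.linearBasis_mem i).2).trans (S.linearBasis_mem i).1)

/-- The linear forms of `R`, mapped to linear forms in `S.dim` variables. -/
noncomputable def linearCoord : MvPolynomial (Fin n) K →ₗ[K] MvPolynomial (Fin S.dim) K :=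
  S.linearBasis.constr K X ∘ₗ S.linearProj

/-- The retraction of `R` onto the polynomial ring to which `S` is isomorphic. -/
noncomputable def coord : MvPolynomial (Fin n) K →ₐ[K] MvPolynomial (Fin S.dim) K :=
  aeval fun j => S.linearCoord (X j)

theorem isHomogeneous_linearCoord (p : MvPolynomial (Fin n) K) :
    (S.linearCoord p).IsHomogeneous 1 := by
  rw [linearCoord, LinearMap.comp_apply, Module.Basis.constr_apply_fintype]
  refine IsHomogeneous.sum _ _ _ fun i _ => ?_
  rw [smul_eq_C_mul]
  exact (isHomogeneous_X K i).C_mul _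

theorem coord_eq_linearCoord {p : MvPolynomial (Fin n) K} (hp : p.IsHomogeneous 1) :
    S.coord p = S.linearCoord p := by
  have hp' : p ∈ Submodule.span K (Set.range X) := by
    rw [← homogeneousSubmodule_one_eq_span_X]; exact hp
  refine LinearMap.eqOn_span (f := S.coord.toLinearMap) (g := S.linearCoord) ?_ hp'
  rintro _ ⟨j, rfl⟩
  exact aeval_X _ j

theorem coord_embed (p : MvPolynomial (Fin S.dim) K) : S.coord (S.embed p) = p := by
  suffices h : S.coord.comp S.embed = AlgHom.id K _ from DFunLike.congr_fun h p
  refine algHom_ext fun i => ?_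
  rw [AlgHom.comp_apply, embed, aeval_X, S.coord_eq_linearCoord (S.linearBasis_mem i).2,
    linearCoord, LinearMap.comp_apply, linearProj_linearBasis, Module.Basis.constr_basis]
  rfl

/-- The projection is determined by the images of the variables, which are linear forms in S. Thus a
basis of S_1 generates S; `coord_embed` shows that it is algebraically independent. -/
theorem embed_coord (p : MvPolynomial (Fin n) K) : S.embed (S.coord p) = S.proj p := by
  suffices h : S.embed.comp S.coord = S.proj from DFunLike.congr_fun h p
  refine algHom_ext fun j => ?_
  rw [AlgHom.comp_apply, coord, aeval_X, linearCoord, LinearMap.comp_apply,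
    Module.Basis.constr_apply_fintype, map_sum, ← S.coe_linearProj (isHomogeneous_X K j)]
  have h := congrArg Subtype.val (S.linearBasis.sum_repr (S.linearProj (X j)))
  rw [AddSubmonoidClass.coe_finsetSum] at h
  rw [← h]
  exact Finset.sum_congr rfl fun i _ => by simp [embed]

theorem proj_embed (p : MvPolynomial (Fin S.dim) K) : S.proj (S.embed p) = S.embed p := by
  rw [← S.embed_coord, S.coord_embed]

theorem isHomogeneous_embed {p : MvPolynomial (Fin S.dim) K} {d : ℕ} (hp : p.IsHomogeneous d) :
    (S.embed p).IsHomogeneous d := by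
  have h := hp.aeval (fun i => (S.linearBasis i : MvPolynomial (Fin n) K)) (n := 1)
    fun i => (S.linearBasis_mem i).2
  rwa [one_mul] at h

theorem isHomogeneous_coord {p : MvPolynomial (Fin n) K} {d : ℕ} (hp : p.IsHomogeneous d) :
    (S.coord p).IsHomogeneous d := by
  have h := hp.aeval (fun j => S.linearCoord (X j)) (n := 1)
    fun j => S.isHomogeneous_linearCoord _
  rwa [one_mul] at h

noncomputable def componentEquiv (d : ℕ) :
    S.component d ≃ₗ[K] homogeneousSubmodule (Fin S.dim) K d where
  toFun p := ⟨S.coord p, S.isHomogeneous_coord (S.mem_component_natCast.mp p.2).2⟩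
  invFun p := ⟨S.embed p, S.mem_component_natCast.mpr ⟨S.proj_embed p, S.isHomogeneous_embed p.2⟩⟩
  map_add' _ _ := Subtype.ext (map_add S.coord _ _)
  map_smul' _ _ := Subtype.ext (map_smul S.coord _ _)
  left_inv p := Subtype.ext ((S.embed_coord _).trans (S.mem_component_natCast.mp p.2).1)
  right_inv _ := Subtype.ext (S.coord_embed _)

theorem finrank_component (d : ℕ) : Module.finrank K (S.component d) = S.dim.multichoose d := by
  rw [(S.componentEquiv d).finrank_eq, finrank_homogeneousSubmodule]

theorem dim_le : S.dim ≤ n := by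
  have h := Submodule.finrank_mono (inf_le_right : S.component 1 ≤ HilbertDepth.component K n 1)
  have h2 : Module.finrank K (HilbertDepth.component K n 1) = n.multichoose 1 :=
    finrank_homogeneousSubmodule 1
  rwa [h2, Nat.multichoose_one_right] at h

/-- The underlying polynomial of an element of `S`. -/
noncomputable def val (p : S.AsModule) : MvPolynomial (Fin n) K :=
  Subtype.val (p := fun x => x ∈ S.proj.range) p

/-- The image of a polynomial in `S`. -/
noncomputable def ofPoly (r : MvPolynomial (Fin n) K) : S.AsModule :=
  (⟨S.proj r, r, rfl⟩ : S.proj.range)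

theorem val_ofPoly (r : MvPolynomial (Fin n) K) : S.val (S.ofPoly r) = S.proj r := rfl

theorem val_injective : Function.Injective S.val := Subtype.val_injective

theorem val_add (p q : S.AsModule) : S.val (p + q) = S.val p + S.val q := rfl

theorem val_smul (r : MvPolynomial (Fin n) K) (p : S.AsModule) :
    S.val (r • p) = S.proj r * S.val p := rfl

theorem proj_val (p : S.AsModule) : S.proj (S.val p) = S.val p := by
  obtain ⟨r, hr⟩ := Subtype.property (p := fun x => x ∈ S.proj.range) p
  have hr : S.proj r = S.val p := hr
  rw [← hr, S.proj_proj]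

noncomputable def asModuleEquiv : S.AsModule ≃+ MvPolynomial (Fin S.dim) K where
  toFun p := S.coord (S.val p)
  invFun p := S.ofPoly (S.embed p)
  map_add' p q := by rw [val_add, map_add]
  left_inv p := S.val_injective (by rw [val_ofPoly, proj_embed, embed_coord, proj_val])
  right_inv p := by simp only [val_ofPoly, proj_embed, coord_embed]

theorem asModuleEquiv_smul (r : MvPolynomial (Fin n) K) (p : S.AsModule) :
    S.asModuleEquiv (r • p) = S.coord r • S.asModuleEquiv p := by
  change S.coord (S.val (r • p)) = S.coord r * S.coord (S.val p)
  rw [val_smul, map_mul, ← S.embed_coord, S.coord_embed]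

theorem constantCoeff_coord {r : MvPolynomial (Fin n) K} (hr : r ∈ maxGradedIdeal K n) :
    constantCoeff (S.coord r) = 0 := by
  have h : maxGradedIdeal K n ≤ RingHom.ker (constantCoeff.comp S.coord.toRingHom) := by
    refine Ideal.span_le.mpr ?_
    rintro _ ⟨j, rfl⟩
    have h := S.isHomogeneous_coord (isHomogeneous_X K j)
    exact h.coeff_eq_zero (by simp)
  exact h hr

theorem length_le_dim {rs : List (MvPolynomial (Fin n) K)}
    (hmem : ∀ x ∈ rs, x ∈ maxGradedIdeal K n)
    (hrs : RingTheory.Sequence.IsWeaklyRegular S.AsModule rs) : rs.length ≤ S.dim := by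
  have h : RingTheory.Sequence.IsWeaklyRegular (MvPolynomial (Fin S.dim) K) (rs.map S.coord) :=
    (S.asModuleEquiv.isWeaklyRegular_congr <| List.forall₂_map_right_iff.mpr <|
      List.forall₂_same.mpr fun r _ x => S.asModuleEquiv_smul r x).mp hrs
  have h2 := length_le_of_isWeaklyRegular_mvPolynomial h (by
    intro r hr
    obtain ⟨s, hs, rfl⟩ := List.mem_map.mp hr
    exact S.constantCoeff_coord (hmem s hs))
  rwa [List.length_map] at h2

/-- The retract `K[X₁, …, X_δ]`. -/
noncomputable def standard (K : Type*) [Field K] (n δ : ℕ) : GradedRetract K n where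
  proj := aeval fun i => if i.1 < δ then X i else 0
  proj_proj p := by
    rw [← AlgHom.comp_apply]
    congr 1
    refine algHom_ext fun i => ?_
    rw [AlgHom.comp_apply, aeval_X]
    split_ifs with h
    · rw [aeval_X, if_pos h]
    · exact map_zero _
  isHomogeneous_proj d p hp := by
    have h := hp.aeval (fun i : Fin n => if i.1 < δ then (X i : MvPolynomial (Fin n) K) else 0)
      (n := 1) fun i => by
        split_ifs
        · exact isHomogeneous_X K i
        · exact isHomogeneous_zero _ _ _
    rwa [one_mul] at h

theorem standard_proj_X {δ : ℕ} (i : Fin n) :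
    (standard K n δ).proj (X i) = if i.1 < δ then X i else 0 := aeval_X _ i

theorem standard_component_one {δ : ℕ} (hδ : δ ≤ n) :
    (standard K n δ).component 1 =
      Submodule.span K (Set.range fun i : Fin δ => X (Fin.castLE hδ i)) := by
  refine le_antisymm ?_ (Submodule.span_le.mpr ?_)
  · intro p hp
    obtain ⟨h1, h2⟩ := (mem_component_natCast _ (d := 1)).mp hp
    have hp' : p ∈ Submodule.span K (Set.range X) := by
      rw [← homogeneousSubmodule_one_eq_span_X]; exact h2
    have h3 := Submodule.mem_map_of_mem (f := (standard K n δ).proj.toLinearMap) hp'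
    rw [Submodule.map_span] at h3
    rw [← h1]
    refine Submodule.span_le.mpr ?_ h3
    rintro _ ⟨_, ⟨i, rfl⟩, rfl⟩
    change (standard K n δ).proj (X i) ∈ Submodule.span K _
    rw [standard_proj_X]
    split_ifs with h
    · exact Submodule.subset_span ⟨⟨i, h⟩, rfl⟩
    · exact zero_mem _
  · rintro _ ⟨i, rfl⟩
    refine (mem_component_natCast _ (d := 1)).mpr ⟨?_, isHomogeneous_X K _⟩
    rw [standard_proj_X, if_pos (by simp)]

theorem standard_dim {δ : ℕ} (hδ : δ ≤ n) : (standard K n δ).dim = δ := by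
  rw [dim, standard_component_one hδ, finrank_span_eq_card]
  · simp
  · exact (linearIndependent_X (Fin n) K).comp _ (Fin.castLE_injective hδ)

/-- The sequence `X₁, …, X_r`. -/
noncomputable def variableList (K : Type*) [Field K] {n r : ℕ} (hr : r ≤ n) :
    List (MvPolynomial (Fin n) K) :=
  List.ofFn fun i : Fin r => X (Fin.castLE hr i)

/-- The ideal generated by the first `i` variables. -/
noncomputable def initialIdeal (K : Type*) [Field K] (n i : ℕ) : Ideal (MvPolynomial (Fin n) K) :=
  Ideal.span (X '' {j : Fin n | j.1 < i})

theorem ofList_take_variableList {r : ℕ} (hr : r ≤ n) {i : ℕ} (hi : i < r) :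
    Ideal.ofList ((variableList K hr).take i) =
      initialIdeal K n i := by
  rw [Ideal.ofList, initialIdeal]
  congr 1
  ext p
  simp only [Set.mem_ofPred_eq, Set.mem_image, List.mem_take_iff_getElem, variableList,
    List.getElem_ofFn, List.length_ofFn]
  constructor
  · rintro ⟨j, hj, rfl⟩
    exact ⟨_, by simp; omega, rfl⟩
  · rintro ⟨j, hj, rfl⟩
    exact ⟨j.1, by omega, rfl⟩

theorem val_mem_of_mem_smul_top {δ i : ℕ} (hi : i ≤ δ) {p : (standard K n δ).AsModule}
    (hp : p ∈ (initialIdeal K n i • ⊤ :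
      Submodule (MvPolynomial (Fin n) K) (standard K n δ).AsModule)) :
    (standard K n δ).val p ∈ initialIdeal K n i := by
  have hle : initialIdeal K n i ≤ (initialIdeal K n i).comap (standard K n δ).proj := by
    refine Ideal.span_le.mpr ?_
    rintro _ ⟨j, hj, rfl⟩
    change (standard K n δ).proj (X j) ∈ initialIdeal K n i
    have hj : j.1 < i := hj
    rw [standard_proj_X, if_pos (by omega)]
    exact Ideal.subset_span ⟨j, hj, rfl⟩
  refine Submodule.smul_induction_on hp (fun r hr x _ => ?_) fun x y hx hy => ?_
  · exact Ideal.mul_mem_right _ _ (hle hr)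
  · exact add_mem hx hy

theorem mem_smul_top_of_val_mem {I : Ideal (MvPolynomial (Fin n) K)} {p : S.AsModule}
    (hp : S.val p ∈ I) :
    p ∈ (I • ⊤ : Submodule (MvPolynomial (Fin n) K) S.AsModule) := by
  have h : p = S.val p • S.ofPoly 1 := S.val_injective (by
    rw [val_smul, val_ofPoly, proj_val, map_one, mul_one])
  rw [h]
  exact Submodule.smul_mem_smul hp Submodule.mem_top

/-- The ideals involved are generated by variables, so membership is tested monomial by monomial;
divisibility by an earlier variable is unaffected by a factor X_i. -/
theorem isWeaklyRegular_variableList {r δ : ℕ} (hr : r ≤ n) (hδ : r ≤ δ) :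
    RingTheory.Sequence.IsWeaklyRegular (standard K n δ).AsModule (variableList K hr) := by
  rw [isWeaklyRegular_iff_smul_mem]
  intro i hi p hp
  have hir : i < r := by simpa [variableList] using hi
  rw [ofList_take_variableList hr hir] at hp ⊢
  refine mem_smul_top_of_val_mem _ ?_
  have h := val_mem_of_mem_smul_top (by omega) hp
  have hX : (variableList K hr)[i] = X ⟨i, hir.trans_le hr⟩ := by
    simp [variableList, Fin.castLE]
  rw [hX] at h
  rw [val_smul, standard_proj_X, if_pos (by simp; omega)] at h
  rw [initialIdeal, mem_ideal_span_X_image] at h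
  rw [initialIdeal, mem_ideal_span_X_image]
  intro m hm
  obtain ⟨j, hj, hmj⟩ := h (Finsupp.single ⟨i, hir.trans_le hr⟩ 1 + m) (by
    rw [mem_support_iff, coeff_X_mul]
    exact mem_support_iff.mp hm)
  refine ⟨j, hj, ?_⟩
  have hne : j ≠ ⟨i, hir.trans_le hr⟩ := fun h => by
    rw [h] at hj; exact lt_irrefl i hj
  simpa [Finsupp.single_eq_of_ne hne] using hmj

theorem variableList_mem {r : ℕ} (hr : r ≤ n) :
    ∀ x ∈ variableList K hr, x ∈ maxGradedIdeal K n := by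
  intro x hx
  obtain ⟨i, rfl⟩ := (List.mem_ofFn' _ _).mp hx
  exact Ideal.subset_span ⟨_, rfl⟩

end GradedRetract

end HilbertDepth

namespace HilbertDepth

/-! ### The Hilbert depth criterion -/

section Criterion

open PowerSeries

variable {K : Type*} [Field K] {n q : ℕ}

theorem finrank_syzygyComponent (d : ℕ) :
    (Module.finrank K (syzygyComponent K n (q + 1) d) : ℤ) =
      coeff d ((PowerSeries.mk 1) ^ n * numerator n q) := finrank_syzygyPart q d

theorem GradedRetract.finrank_component_sub (S : GradedRetract K n) (d s : ℕ) :
    (Module.finrank K (S.component ((d : ℤ) - s)) : ℤ) =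
      coeff d (X ^ s * (PowerSeries.mk 1 : ℤ⟦X⟧) ^ S.dim) := by
  rw [coeff_X_pow_mul', coeff_mk_one_pow]
  split_ifs with h
  · rw [← Nat.cast_sub h, finrank_component]
  · rw [component_of_neg _ (by omega), finrank_bot, Nat.cast_zero]

namespace HilbertDecomposition

variable (D : HilbertDecomposition K n (syzygyComponent K n (q + 1)))

theorem finrank_eq (d : ℤ) : Module.finrank K (syzygyComponent K n (q + 1) d) =
    ∑ i, Module.finrank K ((D.retract i).component (d - D.shift i)) := by
  obtain ⟨e⟩ := D.iso d
  rw [e.finrank_eq, Module.finrank_pi_fintype]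

theorem shift_nonneg (i : Fin D.size) : 0 ≤ D.shift i := by
  by_contra! h
  have h1 := D.finrank_eq (D.shift i)
  have h2 : Module.finrank K (syzygyComponent K n (q + 1) (D.shift i)) = 0 := by
    have : syzygyComponent K n (q + 1) (D.shift i) = ⊥ := syzygyPart_of_neg q h
    rw [this]
    exact finrank_bot K _
  rw [h2, eq_comm, Finset.sum_eq_zero_iff] at h1
  have h3 := h1 i (Finset.mem_univ i)
  rw [sub_self] at h3
  -- In the degree of its shift each retract contributes its constants, of dimension 1, while M(n, q
  -- + 1) vanishes in negative degrees.
  have h4 := (D.retract i).finrank_component 0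
  rw [Nat.cast_zero, h3] at h4
  simp at h4

theorem hilbertSeries_eq : (PowerSeries.mk 1 : ℤ⟦X⟧) ^ n * numerator n q =
    ∑ i, X ^ (D.shift i).toNat * (PowerSeries.mk 1) ^ (D.retract i).dim := by
  ext d
  rw [← finrank_syzygyComponent (K := K), D.finrank_eq, map_sum, Nat.cast_sum]
  refine Finset.sum_congr rfl fun i _ => ?_
  rw [← GradedRetract.finrank_component_sub, Int.toNat_of_nonneg (D.shift_nonneg i)]

/-- An empty decomposition would have infinite depth. It is excluded because M(n, q + 1) ≠ 0 for q +
1 ≤ n. -/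
theorem size_pos (hq : q + 1 ≤ n) : 0 < D.size := by
  by_contra! h
  have h1 := D.hilbertSeries_eq
  have : IsEmpty (Fin D.size) := by
    rw [Nat.le_zero.mp h]; infer_instance
  rw [Finset.univ_eq_empty, Finset.sum_empty] at h1
  have h2 : numerator n q = 0 := by
    have h3 := congrArg ((1 - X : ℤ⟦X⟧) ^ n * ·) h1
    simp only [mul_zero] at h3
    rwa [← mul_assoc, mul_comm ((1 - X : ℤ⟦X⟧) ^ n), mk_one_pow_mul_one_sub_pow, one_mul] at h3
  have h4 := coeff_numerator n q (q + 1)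
  rw [h2, map_zero, if_neg (by omega)] at h4
  have h5 : (n.choose (q + 1) : ℤ) ≠ 0 := by
    exact_mod_cast (Nat.choose_pos hq).ne'
  exact h5 (by simpa using h4.symm)

/-- A sequence regular on the sum is regular on every summand, so every retract has dimension at
least its length. Multiplying the Hilbert series by that power of 1 - X leaves each summand
nonnegative. -/
theorem nonneg_of_isWeaklyRegular (hq : q + 1 ≤ n) {rs : List (MvPolynomial (Fin n) K)}
    (hmem : ∀ x ∈ rs, x ∈ maxGradedIdeal K n)
    (hrs : RingTheory.Sequence.IsWeaklyRegular ((i : Fin D.size) → (D.retract i).AsModule) rs) :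
    rs.length ≤ n ∧ ∀ d, 0 ≤ coeff d ((PowerSeries.mk 1) ^ (n - rs.length) * numerator n q) := by
  rw [isWeaklyRegular_pi_iff] at hrs
  have hdim : ∀ i, rs.length ≤ (D.retract i).dim := fun i =>
    (D.retract i).length_le_dim hmem (hrs i)
  have hn : rs.length ≤ n := (hdim ⟨0, D.size_pos hq⟩).trans (GradedRetract.dim_le _)
  refine ⟨hn, fun d => ?_⟩
  have hcancel : ∀ a, rs.length ≤ a →
      (1 - X : ℤ⟦X⟧) ^ rs.length * (PowerSeries.mk 1) ^ a = (PowerSeries.mk 1) ^ (a - rs.length) := fun a ha => by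
    rw [← Nat.add_sub_cancel' ha, pow_add, ← mul_assoc, mul_comm ((1 - X : ℤ⟦X⟧) ^ _),
      mk_one_pow_mul_one_sub_pow, one_mul, Nat.add_sub_cancel_left]
  have h := congrArg ((1 - X : ℤ⟦X⟧) ^ rs.length * ·) D.hilbertSeries_eq
  simp only [Finset.mul_sum] at h
  rw [← mul_assoc, hcancel n hn] at h
  rw [h, map_sum]
  refine Finset.sum_nonneg fun i _ => ?_
  rw [mul_left_comm, hcancel _ (hdim i), coeff_X_pow_mul', coeff_mk_one_pow]
  split_ifs <;> positivity

theorem depth_le (hq : q + 1 ≤ n) {N : ℕ}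
    (hN : ∀ r, (r ≤ n ∧ ∀ d, 0 ≤ coeff d ((PowerSeries.mk 1) ^ (n - r) * numerator n q)) → r ≤ N) :
    D.depth ≤ N :=
  iSup_le fun rs => Nat.cast_le.mpr (hN _ (D.nonneg_of_isWeaklyRegular hq rs.2.1 rs.2.2))

theorem le_depth {r : ℕ} (hr : r ≤ n) (h : ∀ i, RingTheory.Sequence.IsWeaklyRegular
    (D.retract i).AsModule (GradedRetract.variableList K hr)) : (r : ℕ∞) ≤ D.depth := by
  have h1 := (isWeaklyRegular_pi_iff (GradedRetract.variableList K hr)).mpr h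
  refine le_iSup_of_le ⟨GradedRetract.variableList K hr, GradedRetract.variableList_mem hr, h1⟩ ?_
  simp [GradedRetract.variableList]

end HilbertDecomposition

theorem exists_list_of_mem_hilbertCone {m : ℕ} {f : ℤ⟦X⟧} (hf : f ∈ hilbertCone m) :
    ∃ l : List (ℕ × ℕ), (∀ p ∈ l, p.2 ≤ m) ∧ f = (l.map fun p => X ^ p.1 * (mk 1) ^ p.2).sum := by
  induction hf using AddSubmonoid.closure_induction with
  | mem f hf =>
    obtain ⟨s, e, he, rfl⟩ := hf
    exact ⟨[(s, e)], by simpa using he, by simp⟩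
  | zero => exact ⟨[], by simp, by simp⟩
  | add f g _ _ hf hg =>
    obtain ⟨l, hl, rfl⟩ := hf
    obtain ⟨l', hl', rfl⟩ := hg
    refine ⟨l ++ l', fun p hp => ?_, by simp⟩
    rcases List.mem_append.mp hp with h | h
    · exact hl p h
    · exact hl' p h

/-- Restoring the factor H^r turns each X^s H^e of the cone decomposition into the series of a
shifted standard retract in r + e variables, on which X_1, …, X_r is regular. -/
theorem exists_hilbertDecomposition (hq : q + 1 ≤ n) {r : ℕ} (hr : r ≤ n)
    (h : ∀ d, 0 ≤ coeff d ((mk 1) ^ (n - r) * numerator n q)) :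
    ∃ D : HilbertDecomposition K n (syzygyComponent K n (q + 1)), (r : ℕ∞) ≤ D.depth := by
  obtain ⟨n', rfl⟩ : ∃ n', n = n' + 1 := ⟨n - 1, by omega⟩
  obtain ⟨l, hl, hsum⟩ := exists_list_of_mem_hilbertCone
    (mem_hilbertCone_of_nonneg (show q ≤ n' by omega) h)
  have hdim : ∀ i : Fin l.length,
      (GradedRetract.standard K (n' + 1) (r + l[i].2)).dim = r + l[i].2 := fun i =>
    GradedRetract.standard_dim (by have := hl _ (List.getElem_mem i.2); simp at this ⊢; omega)
  have hseries : (mk 1 : ℤ⟦X⟧) ^ (n' + 1) * numerator (n' + 1) q =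
      ∑ i : Fin l.length, X ^ l[i].1 *
        (mk 1) ^ (GradedRetract.standard K (n' + 1) (r + l[i].2)).dim := by
    rw [show (mk 1 : ℤ⟦X⟧) ^ (n' + 1) = (mk 1) ^ r * (mk 1) ^ (n' + 1 - r) by
      rw [← pow_add, Nat.add_sub_cancel' hr], mul_assoc, hsum, ← Fin.sum_univ_fun_getElem,
      Finset.mul_sum]
    refine Finset.sum_congr rfl fun i _ => ?_
    rw [hdim i, pow_add]
    exact mul_left_comm _ _ _
  refine ⟨{ size := l.length
            retract := fun i => GradedRetract.standard K (n' + 1) (r + l[i].2)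
            shift := fun i => l[i].1
            iso := fun d => ?_ }, ?_⟩
  · have hfd : FiniteDimensional K (syzygyComponent K (n' + 1) (q + 1) d) :=
      finiteDimensional_syzygyPart q d
    refine FiniteDimensional.nonempty_linearEquiv_of_finrank_eq ?_
    rw [Module.finrank_pi_fintype]
    rcases lt_or_ge d 0 with hd | hd
    · have h0 : syzygyComponent K (n' + 1) (q + 1) d = ⊥ := syzygyPart_of_neg q hd
      rw [h0, Finset.sum_eq_zero]
      · exact finrank_bot K _
      · intro i _
        rw [GradedRetract.component_of_neg _ (by omega), finrank_bot]
    · lift d to ℕ using hd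
      zify
      rw [finrank_syzygyComponent, hseries, map_sum]
      exact Finset.sum_congr rfl fun i _ => (GradedRetract.finrank_component_sub _ _ _).symm
  · exact HilbertDecomposition.le_depth _ hr fun i =>
      GradedRetract.isWeaklyRegular_variableList hr (Nat.le_add_right _ _)

/-- The admissible r are bounded by n and closed downwards, and r = 0 is admissible; their maximum
is the Hilbert depth. Hence the supremum is finite and `toNat` loses nothing. -/
theorem le_toNat_hdepth_iff (hq : q + 1 ≤ n) (r : ℕ) :
    r ≤ (hdepth K n (syzygyComponent K n (q + 1))).toNat ↔
      r ≤ n ∧ ∀ d, 0 ≤ coeff d ((mk 1) ^ (n - r) * numerator n q) := by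
  classical
  have hex : ∃ N ≤ n, (N ≤ n ∧ ∀ d, 0 ≤ coeff d ((mk 1) ^ (n - N) * numerator n q)) ∧
      ∀ r, (r ≤ n ∧ ∀ d, 0 ≤ coeff d ((mk 1) ^ (n - r) * numerator n q)) → r ≤ N := by
    have h0 : (0 ≤ n ∧ ∀ d, 0 ≤ coeff d ((PowerSeries.mk 1) ^ (n - 0) * numerator n q)) :=
      ⟨Nat.zero_le n, coeff_mk_one_pow_mul_numerator_self_nonneg n q⟩
    have h1 := Nat.findGreatest_spec (P := fun r => r ≤ n ∧
      ∀ d, 0 ≤ coeff d ((PowerSeries.mk 1) ^ (n - r) * numerator n q)) (Nat.zero_le n) h0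
    exact ⟨_, (h1 : _ ∧ _).1, h1, fun r hr => Nat.le_findGreatest hr.1 hr⟩
  obtain ⟨N, -, hN, hmax⟩ := hex
  obtain ⟨D, hD⟩ := exists_hilbertDecomposition (K := K) hq hN.1 hN.2
  have h : hdepth K n (syzygyComponent K n (q + 1)) = N :=
    le_antisymm (iSup_le fun D => D.depth_le hq hmax) (hD.trans (le_iSup _ D))
  rw [h, ENat.toNat_natCast]
  refine ⟨fun hr => ⟨hr.trans hN.1, ?_⟩, hmax r⟩
  rw [show n - r = (N - r) + (n - N) by have := hN.1; omega]
  intro d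
  rw [pow_add, mul_assoc]
  exact coeff_mk_one_pow_mul_nonneg hN.2 _ d

end Criterion

end HilbertDepth

theorem theorem4p1 (K : Type*) [Field K] (k : ℕ) (hk : 1 ≤ k) :
    (fun n : ℕ =>
        ((HilbertDepth.hdepth K n (HilbertDepth.syzygyComponent K n k)).toNat : ℝ) -
          ((1 / 2 : ℝ) * (n : ℝ)
            + (1 / 2 : ℝ) * Real.sqrt (((k : ℝ) - 1) * (n : ℝ) * Real.log (n : ℝ))
            + (1 / 4 : ℝ) * Real.sqrt (((k : ℝ) - 1) * (n : ℝ) / Real.log (n : ℝ))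
                * Real.log (Real.log (n : ℝ))))
      =o[atTop]
        (fun n : ℕ => Real.sqrt ((n : ℝ) / Real.log (n : ℝ)) * Real.log (Real.log (n : ℝ))) := by
  obtain ⟨q, rfl⟩ := Nat.exists_eq_add_of_le' hk
  have h : ((q + 1 : ℕ) : ℝ) - 1 = q := by push_cast; ring
  rw [h]
  -- The criterion is available for n ≥ k; smaller n do not affect the limit.
  exact HilbertDepth.isLittleO_of_criterion fun n hn r => HilbertDepth.le_toNat_hdepth_iff hn r
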